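/- Let $G\ge 1$ be the number of clusters, $p$ the number of covariates, and let $\theta$ consist of coefficient vectors $\boldsymbol\beta_g=(\beta_{g,0},\dots,\beta_{g,p})^T$ and variances $\sigma_g^2>0$ for $g=1,\dots,G$, and of $\pi_1,\dots,\pi_{G-1}$, where $\pi_G=1-\sum_{g<G}\pi_g$ and all $\pi_g>0$; thus $\theta$ has $Gp+3G-1$ components. In the clusterwise linear regression model, a data point with covariate vector $\mathbf z$, $\mathbf x=(1,\mathbf z^T)^T$, has a latent cluster indicator $\boldsymbol I=(I_1,\dots,I_G)$ with $P(I_g=1)=\pi_g$, and given $I_g=1$ its response $y$ has the density $\phi_g=\phi(\cdot\mid \mathbf x^T\boldsymbol\beta_g,\sigma_g^2)$ of $N(\mathbf x^T\boldsymbol\beta_g,\sigma_g^2)$, so that $y\sim\sum_g\pi_g\phi_g$. For given $\mathbf x$, let $\boldsymbol I(\mathbf x)$, $\boldsymbol I_C(\mathbf x)$ and $\boldsymbol I_M(\mathbf x)$ be the Fisher information matrices $E(ss^T)$, where $s$ is the gradient in $\theta$ of the logarithm of, respectively, the observed likelihood $\sum_g\pi_g\phi_g(y)$, the complete-data likelihood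 $\prod_g(\pi_g\phi_g(y))^{I_g}$, and the conditional likelihood of $\boldsymbol I$ given $y$ (the ratio of the second to the first), and $E$ is the expectation at $\theta$ given $\mathbf x$. Let $\boldsymbol\Sigma_z=\boldsymbol\Phi_z\boldsymbol\rho\boldsymbol\Phi_z$ be a positive definite covariance matrix, with $\boldsymbol\Phi_z=\mathrm{diag}(\sigma_{z1},\dots,\sigma_{zp})$, $\sigma_{zj}>0$, and $\boldsymbol\rho=(\rho_{jj'})$ a correlation matrix, and let $\boldsymbol\mu_z\in\mathbb R^p$. Let $\mathbf z_1,\mathbf z_2,\dots$ be iid and let one of the following hold: (a) $\mathbf z_i\sim N(\boldsymbol\mu_z,\boldsymbol\Sigma_z)$, and $\sum_{l=1}^p\rho_{lj}\sigma_{zl}(\beta_{g,l}-\beta_{g',l})\ne 0$ for all $g\ne g'$ and all $j\in\{1,\dots,p\}$; (b) $\mathbf z_i\sim LN(\boldsymbol\mu_z,\boldsymbol\Sigma_z)$ (the coordinatewise exponential of an $N(\boldsymbol\mu_z,\boldsymbol\Sigma_z)$ vector), and for all $g\ne g'$ and all $j\in\{1,\dots,p\}$: $\beta_{g,j}-\beta_{g',j}\neq0$,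 $\sum_{l\in\mathcal L_{\min,j}}(\beta_{g,l}-\beta_{g',l})\ne0$ and $\rho_{\min,j}<0$, where $\rho_{\min,j}=\min_l\rho_{lj}$ and $\mathcal L_{\min,j}=\{l:\rho_{lj}=\rho_{\min,j}\}$. Fix $r$. For each $N$ let $\boldsymbol\delta^*=\boldsymbol\delta^*_N\subset\{1,\dots,N\}$ be the subdata (of size $k=2pr$ once $N\ge 2pr$) selected from $\mathbf z_1,\dots,\mathbf z_N$ as follows: sequentially for $j=1,\dots,p$, among the data points not selected before, select those with the $r$ smallest and those with the $r$ largest values of the $j$th covariate (ties, which have probability $0$, being broken by the index). Then, writing $\mathbf x_i=(1,\mathbf z_i^T)^T$, $$\sum_{i\in\boldsymbol\delta^*}\boldsymbol I_M(\mathbf x_i)\xrightarrow{\ \mathbb P\ }\boldsymbol 0_{(Gp+3G-1)\times(Gp+3G-1)}\qquad(N\to\infty).$$ Moreover, for every $\mathbf x=(1,\mathbf z^T)^T$, $\boldsymbol I(\mathbf x)=\boldsymbol I_C(\mathbf x)-\boldsymbol I_M(\mathbf x)$, and $\boldsymbol I_C(\mathbf x)$ has the closed form of the block diagonal matrix with blocks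 $\pi_g\mathbf x\mathbf x^T/\sigma_g^2$ $(g\le G)$ for the $\boldsymbol\beta_g$, entries $\pi_g/(2\sigma_g^4)$ $(g\le G)$ for the $\sigma_g^2$, and the block $\mathrm{diag}(1/\pi_1,\dots,1/\pi_{G-1})+\frac1{\pi_G}\mathbf 1\mathbf 1^T$ for $(\pi_1,\dots,\pi_{G-1})$. Consequently $\sum_{i\in\boldsymbol\delta^*}\boldsymbol I_C(\mathbf x_i)-\sum_{i\in\boldsymbol\delta^*}\boldsymbol I(\mathbf x_i)\xrightarrow{\mathbb P}\boldsymbol 0$. -/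

import Mathlib

open MeasureTheory ProbabilityTheory Filter
open scoped Topology

noncomputable section

namespace CLR

/-- Index set of the free parameters of a clusterwise linear regression model with `G = m + 1`
clusters and `p` covariates: the coefficients `β_{g,a}` (with `a = 0` the intercept), the
variances `σ_g²`, and the first `G - 1` mixing proportions `π_g`.
It has `G (p + 1) + G + (G - 1) = G p + 3 G - 1` elements. -/
abbrev Idx (m p : ℕ) : Type := (Fin (m + 1) × Fin (p + 1)) ⊕ (Fin (m + 1) ⊕ Fin m)

variable {m p : ℕ}

/-- The coefficient `β_{g,a}`; `a = 0` is the intercept and `a = l.succ` the slope of covariate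
`l`. -/
def coef (θ : Idx m p → ℝ) (g : Fin (m + 1)) (a : Fin (p + 1)) : ℝ := θ (.inl (g, a))

/-- The error variance `σ_g²` of cluster `g`. -/
def var (θ : Idx m p → ℝ) (g : Fin (m + 1)) : ℝ := θ (.inr (.inl g))

/-- The mixing proportions: `π_1, …, π_{G-1}` are free parameters and
`π_G = 1 - (π_1 + ⋯ + π_{G-1})`. -/
def prop (θ : Idx m p → ℝ) : Fin (m + 1) → ℝ :=
  Fin.snoc (α := fun _ => ℝ) (fun g : Fin m => θ (.inr (.inr g)))
    (1 - ∑ g : Fin m, θ (.inr (.inr g)))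

/-- The vector `x = (1, z₁, …, z_p)`. -/
def design (z : EuclideanSpace ℝ (Fin p)) : Fin (p + 1) → ℝ :=
  Fin.cons (α := fun _ => ℝ) 1 (fun l => z l)

/-- The linear predictor `xᵀ β_g`. -/
def linPred (θ : Idx m p → ℝ) (z : EuclideanSpace ℝ (Fin p)) (g : Fin (m + 1)) : ℝ :=
  ∑ a, design z a * coef θ g a

/-- The normal density `φ(y | xᵀ β_g, σ_g²)` of the response in cluster `g`. -/
def dens (θ : Idx m p → ℝ) (z : EuclideanSpace ℝ (Fin p)) (y : ℝ) (g : Fin (m + 1)) : ℝ :=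
  gaussianPDFReal (linPred θ z g) (var θ g).toNNReal y

/-- The likelihood `∑_g π_g φ_g` of an observed response `y`. -/
def obsLik (θ : Idx m p → ℝ) (z : EuclideanSpace ℝ (Fin p)) (y : ℝ) : ℝ :=
  ∑ g, prop θ g * dens θ z y g

/-- The latent indicator `I_g` when the data point belongs to cluster `c`. -/
def indicator (c g : Fin (m + 1)) : ℕ := if c = g then 1 else 0

/-- The likelihood `∏_g (φ_g π_g) ^ I_g` of a complete data point: the response together with its
cluster. -/
def complLik (θ : Idx m p → ℝ) (z : EuclideanSpace ℝ (Fin p)) (d : ℝ × Fin (m + 1)) : ℝ :=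
  ∏ g, (dens θ z d.1 g * prop θ g) ^ indicator d.2 g

/-- The likelihood of the latent indicators in their conditional distribution given the
response. -/
def condLik (θ : Idx m p → ℝ) (z : EuclideanSpace ℝ (Fin p)) (d : ℝ × Fin (m + 1)) : ℝ :=
  complLik θ z d / obsLik θ z d.1

/-- The law of the response at the covariate vector `z`, that is, the normal mixture
`∑_g π_g N(xᵀ β_g, σ_g²)`. -/
def obsLaw (θ : Idx m p → ℝ) (z : EuclideanSpace ℝ (Fin p)) : Measure ℝ :=
  ∑ g, ENNReal.ofReal (prop θ g) • gaussianReal (linPred θ z g) (var θ g).toNNReal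

/-- The joint law of the response and of its cluster at the covariate vector `z`. -/
def complLaw (θ : Idx m p → ℝ) (z : EuclideanSpace ℝ (Fin p)) : Measure (ℝ × Fin (m + 1)) :=
  ∑ g, ENNReal.ofReal (prop θ g) •
    (gaussianReal (linPred θ z g) (var θ g).toNNReal).map (fun y => (y, g))

/-- The score: the vector of partial derivatives of the log-likelihood in the parameters. -/
def score {Y : Type*} (L : (Idx m p → ℝ) → Y → ℝ) (θ : Idx m p → ℝ) (y : Y) (a : Idx m p) : ℝ :=
  deriv (fun t => Real.log (L (Function.update θ a t) y)) (θ a)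

/-- The Fisher information matrix `E[s sᵀ]`, with `s` the score of the likelihood `L` and the
expectation taken under `ν`. -/
def fisherInfo {Y : Type*} [MeasurableSpace Y] (ν : Measure Y) (L : (Idx m p → ℝ) → Y → ℝ)
    (θ : Idx m p → ℝ) : Matrix (Idx m p) (Idx m p) ℝ :=
  Matrix.of fun a b => ∫ y, score L θ y a * score L θ y b ∂ν

/-- The Fisher information of a data point with covariate vector `z`. -/
def info (θ : Idx m p → ℝ) (z : EuclideanSpace ℝ (Fin p)) : Matrix (Idx m p) (Idx m p) ℝ :=
  fisherInfo (obsLaw θ z) (fun θ' y => obsLik θ' z y) θ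

/-- The complete-data Fisher information of a data point with covariate vector `z`. -/
def complInfo (θ : Idx m p → ℝ) (z : EuclideanSpace ℝ (Fin p)) : Matrix (Idx m p) (Idx m p) ℝ :=
  fisherInfo (complLaw θ z) (fun θ' d => complLik θ' z d) θ

/-- The missing information of a data point with covariate vector `z`: the information in the
conditional distribution of the latent indicators given the response. -/
def missInfo (θ : Idx m p → ℝ) (z : EuclideanSpace ℝ (Fin p)) : Matrix (Idx m p) (Idx m p) ℝ :=
  fisherInfo (complLaw θ z) (fun θ' d => condLik θ' z d) θ

/-- The closed form of the complete-data information: block diagonal, with the blocks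
`π_g x xᵀ / σ_g²`, the entries `π_g / (2 σ_g⁴)`, and the block
`diag(1/π_1, …, 1/π_{G-1}) + (1/π_G) 1 1ᵀ`. -/
def closedForm (θ : Idx m p → ℝ) (z : EuclideanSpace ℝ (Fin p)) :
    Matrix (Idx m p) (Idx m p) ℝ :=
  Matrix.of fun i j =>
    match i, j with
    | .inl (g, a), .inl (h, b) =>
        if g = h then prop θ g * (design z a * design z b) / var θ g else 0
    | .inr (.inl g), .inr (.inl h) => if g = h then prop θ g / (2 * var θ g ^ 2) else 0
    | .inr (.inr g), .inr (.inr h) =>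
        (if g = h then 1 / prop θ g.castSucc else 0) + 1 / prop θ (Fin.last m)
    | _, _ => 0

open Classical in
/-- The points of `S` with the `r` smallest or the `r` largest values of `v`
(ties are broken by the index). -/
def extremes (r : ℕ) (v : ℕ → ℝ) (S : Finset ℕ) : Finset ℕ :=
  S.filter fun i =>
    (S.filter fun k => v k < v i ∨ (v k = v i ∧ k < i)).card < r ∨
    (S.filter fun k => v i < v k ∨ (v k = v i ∧ i < k)).card < r

/-- The subdata selected from the data points `0, …, N - 1`: sequentially for the covariates
`j = 1, …, p`, the points with the `r` smallest and the `r` largest values of the `j`th covariate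
among the points that have not been selected before. -/
def iboss (r N : ℕ) (z : ℕ → EuclideanSpace ℝ (Fin p)) : Finset ℕ :=
  (List.finRange p).foldl
    (fun D j => D ∪ extremes r (fun i => z i j) (Finset.range N \ D)) ∅

/-- The multivariate normal law `N(μ, Φ ρ Φ)`, with `Φ = diag(σ₁, …, σ_p)`. -/
def normalLaw (μ : EuclideanSpace ℝ (Fin p)) (σ : Fin p → ℝ) (ρ : Matrix (Fin p) (Fin p) ℝ) :
    Measure (EuclideanSpace ℝ (Fin p)) :=
  multivariateGaussian μ (Matrix.diagonal σ * ρ * Matrix.diagonal σ)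

/-- The multivariate lognormal law `LN(μ, Φ ρ Φ)`: the law of `(exp u₁, …, exp u_p)` for `u` with
law `N(μ, Φ ρ Φ)`. -/
def lognormalLaw (μ : EuclideanSpace ℝ (Fin p)) (σ : Fin p → ℝ) (ρ : Matrix (Fin p) (Fin p) ℝ) :
    Measure (EuclideanSpace ℝ (Fin p)) :=
  (normalLaw μ σ ρ).map fun u => WithLp.toLp 2 fun j => Real.exp (u j)

/-- `ρ_{min,j} = min_l ρ_{lj}`. -/
def rhoMin (ρ : Matrix (Fin p) (Fin p) ℝ) (j : Fin p) : ℝ := ⨅ l, ρ l j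

open Classical in
/-- `L_{min,j} = {l | ρ_{lj} = ρ_{min,j}}`. -/
def argRhoMin (ρ : Matrix (Fin p) (Fin p) ℝ) (j : Fin p) : Finset (Fin p) :=
  Finset.univ.filter fun l => ρ l j = rhoMin ρ j

/-- The condition on the slopes for normal covariates:
`∑_l ρ_{lj} σ_l (β_{g,l} - β_{g',l}) ≠ 0` for all `g ≠ g'` and all `j`. -/
def NormalCond (θ : Idx m p → ℝ) (σ : Fin p → ℝ) (ρ : Matrix (Fin p) (Fin p) ℝ) : Prop :=
  ∀ g g' : Fin (m + 1), g ≠ g' → ∀ j : Fin p,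
    ∑ l, ρ l j * σ l * (coef θ g l.succ - coef θ g' l.succ) ≠ 0

/-- The condition on the slopes and the correlations for lognormal covariates:
`β_{g,j} - β_{g',j} ≠ 0`, `∑_{l ∈ L_{min,j}} (β_{g,l} - β_{g',l}) ≠ 0` and `ρ_{min,j} < 0` for all
`g ≠ g'` and all `j`. -/
def LognormalCond (θ : Idx m p → ℝ) (ρ : Matrix (Fin p) (Fin p) ℝ) : Prop :=
  ∀ g g' : Fin (m + 1), g ≠ g' → ∀ j : Fin p,
    coef θ g j.succ - coef θ g' j.succ ≠ 0 ∧
    ∑ l ∈ argRhoMin ρ j, (coef θ g l.succ - coef θ g' l.succ) ≠ 0 ∧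
    rhoMin ρ j < 0

end CLR

end

/-! Write w_g = π_g φ_g(y) and W = ∑ w_g. The score of the observed likelihood is the posterior mean
of the component scores s_g, with posterior weights w_g / W. The score of the conditional likelihood
is s_g minus this mean. The missing information principle is then the decomposition of a second
moment into that of the mean plus the variance, and the closed form of the complete information
follows from the Gaussian moments up to order four.

The diagonal of the missing information integrates a posterior variance, which is at most a sum over
g ≠ h of (w_g w_h / W) (s_g - s_h)². Since w_g w_h / W ≤ √(w_g w_h), each term is small unless y is
close to both regression lines. Integration over y gives the bound `sepBound`, a constant times ∑ (1
+ ‖z‖²) exp(-κ Δ²), with Δ the difference of the two linear predictors (`exists_missInfo_le`).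

It remains to show that this bound is uniformly small on the subdata, with high probability. A
selected point has fewer than K = r + 2rp sample points strictly beyond it in some covariate and
direction (`mem_iboss`), and K does not depend on N. Put a threshold where the expected number of
points beyond it is a large constant L. Then all selected points lie beyond such thresholds, up to
small probability, and the expected number of points beyond them where the bound is not small is L
times a conditional tail probability (`tendsto_measure_exists_largest_mem`). For a Gaussian vector u
this conditional probability tends to 0: u = s c + R, with s the signed covariate ± u_j, c the
regression direction and R independent of s, so it suffices that the bound vanishes along almost
every ray s → ∞ (`exists_tail_le`).

For normal covariates z/s → c, and the condition on the slopes makes Δ grow linearly in s. For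
lognormal covariates the selection is the same for z and log z; the coordinates with the largest
entry of c grow fastest, exponentially because that entry is positive, and the leading coefficient
of Δ is almost surely nonzero. -/

noncomputable section

namespace CLR

/-! ### Scores and the missing information principle -/

section

variable {m p : ℕ}

/-- The partial derivatives of `log (π_g φ_g(y))` in the parameters. -/
def compScore (θ : Idx m p → ℝ) (z : EuclideanSpace ℝ (Fin p)) (g : Fin (m + 1)) (a : Idx m p)
    (y : ℝ) : ℝ :=
  match a with
  | .inl (h, k) => if h = g then design z k * (y - linPred θ z g) / var θ g else 0
  | .inr (.inl h) =>
      if h = g then (y - linPred θ z g) ^ 2 / (2 * var θ g ^ 2) - 1 / (2 * var θ g) else 0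
  | .inr (.inr h) =>
      (if h.castSucc = g then 1 / prop θ h.castSucc else 0) -
        (if g = Fin.last m then 1 / prop θ (Fin.last m) else 0)

lemma prop_castSucc (θ : Idx m p → ℝ) (g : Fin m) : prop θ g.castSucc = θ (.inr (.inr g)) := by
  simp [prop]

lemma prop_last (θ : Idx m p → ℝ) :
    prop θ (Fin.last m) = 1 - ∑ g : Fin m, θ (.inr (.inr g)) := by
  simp [prop]

lemma hasDerivAt_update_apply (θ : Idx m p → ℝ) (a b : Idx m p) (t : ℝ) :
    HasDerivAt (fun t => Function.update θ a t b) (Pi.single (M := fun _ => ℝ) a 1 b) t :=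
  hasDerivAt_pi.1 (hasDerivAt_update θ a t) b

lemma hasDerivAt_prop (θ : Idx m p → ℝ) (a : Idx m p) (g : Fin (m + 1)) :
    HasDerivAt (fun t => prop (Function.update θ a t) g)
      (match a with
        | .inr (.inr h) => (if h.castSucc = g then 1 else 0) - (if g = Fin.last m then 1 else 0)
        | _ => 0) (θ a) := by
  induction g using Fin.lastCases with
  | last =>
    simp only [prop_last]
    have h := (HasDerivAt.fun_sum (u := Finset.univ) (fun (g : Fin m) _ =>
      hasDerivAt_update_apply θ a (.inr (.inr g)) (θ a))).const_sub 1
    refine h.congr_deriv ?_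
    rcases a with ⟨h, k⟩ | h | h <;> simp [Pi.single_apply, Fin.castSucc_ne_last]
  | cast g =>
    simp only [prop_castSucc]
    refine (hasDerivAt_update_apply θ a (.inr (.inr g)) (θ a)).congr_deriv ?_
    rcases a with ⟨h, k⟩ | h | h <;>
      simp [Pi.single_apply, Fin.castSucc_ne_last, eq_comm]

lemma hasDerivAt_var (θ : Idx m p → ℝ) (a : Idx m p) (g : Fin (m + 1)) :
    HasDerivAt (fun t => var (Function.update θ a t) g)
      (match a with
        | .inr (.inl h) => if h = g then 1 else 0
        | _ => 0) (θ a) := by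
  refine (hasDerivAt_update_apply θ a (.inr (.inl g)) (θ a)).congr_deriv ?_
  rcases a with ⟨h, k⟩ | h | h <;> simp [Pi.single_apply, eq_comm]

lemma hasDerivAt_linPred (θ : Idx m p → ℝ) (z : EuclideanSpace ℝ (Fin p)) (a : Idx m p)
    (g : Fin (m + 1)) :
    HasDerivAt (fun t => linPred (Function.update θ a t) z g)
      (match a with
        | .inl (h, k) => if h = g then design z k else 0
        | _ => 0) (θ a) := by
  refine (HasDerivAt.fun_sum (u := Finset.univ) (fun (k : Fin (p + 1)) _ =>
      (hasDerivAt_update_apply θ a (.inl (g, k)) (θ a)).const_mul (design z k))).congr_deriv ?_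
  rcases a with ⟨h, k⟩ | h | h
  · by_cases hg : h = g
    · subst hg; simp [Pi.single_apply]
    · simp [hg, Ne.symm hg]
  · simp
  · simp

lemma eventually_var_pos {θ : Idx m p → ℝ} (hvar : ∀ g, 0 < var θ g) (a : Idx m p)
    (g : Fin (m + 1)) : ∀ᶠ t in 𝓝 (θ a), 0 < var (Function.update θ a t) g :=
  (hasDerivAt_var θ a g).continuousAt.eventually_const_lt (by simpa using hvar g)

lemma eventually_prop_pos {θ : Idx m p → ℝ} (hprop : ∀ g, 0 < prop θ g) (a : Idx m p)
    (g : Fin (m + 1)) : ∀ᶠ t in 𝓝 (θ a), 0 < prop (Function.update θ a t) g :=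
  (hasDerivAt_prop θ a g).continuousAt.eventually_const_lt (by simpa using hprop g)

lemma dens_eq {θ : Idx m p → ℝ} {g : Fin (m + 1)} (hv : 0 < var θ g)
    (z : EuclideanSpace ℝ (Fin p)) (y : ℝ) :
    dens θ z y g = (√(2 * Real.pi * var θ g))⁻¹ *
      Real.exp (-(y - linPred θ z g) ^ 2 / (2 * var θ g)) := by
  simp [dens, gaussianPDFReal, Real.coe_toNNReal _ hv.le]

lemma dens_pos {θ : Idx m p → ℝ} {g : Fin (m + 1)} (hv : 0 < var θ g)
    (z : EuclideanSpace ℝ (Fin p)) (y : ℝ) : 0 < dens θ z y g :=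
  gaussianPDFReal_pos _ _ _ (by simpa using hv)

lemma log_dens_mul_prop {θ : Idx m p → ℝ} {g : Fin (m + 1)} (hv : 0 < var θ g)
    (hp : 0 < prop θ g) (z : EuclideanSpace ℝ (Fin p)) (y : ℝ) :
    Real.log (dens θ z y g * prop θ g) =
      -(1 / 2 * Real.log (2 * Real.pi * var θ g)) - (y - linPred θ z g) ^ 2 / (2 * var θ g) +
        Real.log (prop θ g) := by
  have h0 : 0 < 2 * Real.pi * var θ g := by positivity
  rw [Real.log_mul (dens_pos hv z y).ne' hp.ne', dens_eq hv, Real.log_mul (by positivity)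
    (Real.exp_ne_zero _), Real.log_exp, Real.log_inv, Real.log_sqrt h0.le]
  ring

lemma hasDerivAt_log_dens_mul_prop {θ : Idx m p → ℝ} (hvar : ∀ g, 0 < var θ g)
    (hprop : ∀ g, 0 < prop θ g) (z : EuclideanSpace ℝ (Fin p)) (y : ℝ) (g : Fin (m + 1))
    (a : Idx m p) :
    HasDerivAt (fun t => Real.log (dens (Function.update θ a t) z y g *
      prop (Function.update θ a t) g)) (compScore θ z g a y) (θ a) := by
  have hV := hasDerivAt_var θ a g
  have hM := hasDerivAt_linPred θ z a g
  have hP := hasDerivAt_prop θ a g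
  have hv := hvar g
  have hp := hprop g
  have key := (((hV.const_mul (2 * Real.pi)).log (by simp; positivity)).const_mul (1 / 2)).neg.sub
    (((hM.const_sub y).pow 2).div (hV.const_mul 2) (by simp; positivity)) |>.add
    (hP.log (by simpa using hp.ne'))
  have hev : (fun t => Real.log (dens (Function.update θ a t) z y g *
      prop (Function.update θ a t) g)) =ᶠ[𝓝 (θ a)] fun t =>
      -(1 / 2 * Real.log (2 * Real.pi * var (Function.update θ a t) g)) -
        (y - linPred (Function.update θ a t) z g) ^ 2 / (2 * var (Function.update θ a t) g) +
        Real.log (prop (Function.update θ a t) g) := by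
    filter_upwards [eventually_var_pos hvar a g, eventually_prop_pos hprop a g] with t h1 h2
    exact log_dens_mul_prop h1 h2 z y
  refine (HasDerivAt.congr_of_eventuallyEq key hev).congr_deriv ?_
  have := Real.pi_pos
  rcases a with ⟨h, k⟩ | h | h
  · by_cases hg : h = g
    · simp [compScore, hg]; field_simp
    · simp [compScore, hg]
  · by_cases hg : h = g
    · simp [compScore, hg]; field_simp; ring
    · simp [compScore, hg]
  · induction g using Fin.lastCases with
    | last => simp [compScore, Fin.castSucc_ne_last, neg_div]
    | cast g =>
      by_cases hg : h = g
      · subst hg; simp [compScore, Fin.castSucc_ne_last]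
      · simp [compScore, hg, Fin.castSucc_ne_last]

lemma complLik_eq (θ : Idx m p → ℝ) (z : EuclideanSpace ℝ (Fin p)) (y : ℝ) (c : Fin (m + 1)) :
    complLik θ z (y, c) = dens θ z y c * prop θ c := by
  simp [complLik, indicator, pow_ite, Finset.prod_ite_eq]

/-- The identity w' = w (log w)', obtained by exponentiating the logarithm, which is legitimate near
`θ a` because the weights stay positive there. -/
lemma hasDerivAt_dens_mul_prop {θ : Idx m p → ℝ} (hvar : ∀ g, 0 < var θ g)
    (hprop : ∀ g, 0 < prop θ g) (z : EuclideanSpace ℝ (Fin p)) (y : ℝ) (g : Fin (m + 1))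
    (a : Idx m p) :
    HasDerivAt (fun t => prop (Function.update θ a t) g * dens (Function.update θ a t) z y g)
      (prop θ g * dens θ z y g * compScore θ z g a y) (θ a) := by
  have h := (hasDerivAt_log_dens_mul_prop hvar hprop z y g a).exp
  have hpos : 0 < dens θ z y g * prop θ g := mul_pos (dens_pos (hvar g) z y) (hprop g)
  simp only [Function.update_eq_self] at h
  rw [Real.exp_log hpos, mul_comm (dens _ _ _ _)] at h
  refine h.congr_of_eventuallyEq ?_
  filter_upwards [eventually_var_pos hvar a g, eventually_prop_pos hprop a g] with t h1 h2
  rw [Real.exp_log (mul_pos (dens_pos h1 z y) h2), mul_comm]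

/-- The conditional probability of cluster `g` given the response. -/
def postProb (θ : Idx m p → ℝ) (z : EuclideanSpace ℝ (Fin p)) (g : Fin (m + 1)) (y : ℝ) : ℝ :=
  prop θ g * dens θ z y g / obsLik θ z y

/-- The posterior mean of the component scores. -/
def meanScore (θ : Idx m p → ℝ) (z : EuclideanSpace ℝ (Fin p)) (a : Idx m p) (y : ℝ) : ℝ :=
  ∑ g, postProb θ z g y * compScore θ z g a y

lemma obsLik_pos {θ : Idx m p → ℝ} (hvar : ∀ g, 0 < var θ g)
    (hprop : ∀ g, 0 < prop θ g) (z : EuclideanSpace ℝ (Fin p)) (y : ℝ) : 0 < obsLik θ z y :=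
  Finset.sum_pos (fun g _ => mul_pos (hprop g) (dens_pos (hvar g) z y)) Finset.univ_nonempty

/-- Fisher's identity: (log ∑ w_g)' = ∑ (w_g / W) (log w_g)'. -/
lemma hasDerivAt_log_obsLik {θ : Idx m p → ℝ} (hvar : ∀ g, 0 < var θ g)
    (hprop : ∀ g, 0 < prop θ g) (z : EuclideanSpace ℝ (Fin p)) (y : ℝ) (a : Idx m p) :
    HasDerivAt (fun t => Real.log (obsLik (Function.update θ a t) z y))
      (meanScore θ z a y) (θ a) := by
  have h := (HasDerivAt.fun_sum (u := Finset.univ) (fun (g : Fin (m + 1)) _ =>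
    hasDerivAt_dens_mul_prop hvar hprop z y g a)).log
    (by simpa [obsLik] using (obsLik_pos hvar hprop z y).ne')
  refine h.congr_deriv ?_
  simp only [Function.update_eq_self, meanScore, postProb, Finset.sum_div, obsLik]
  exact Finset.sum_congr rfl fun g _ => by ring

lemma score_complLik {θ : Idx m p → ℝ} (hvar : ∀ g, 0 < var θ g)
    (hprop : ∀ g, 0 < prop θ g) (z : EuclideanSpace ℝ (Fin p)) (y : ℝ) (c : Fin (m + 1))
    (a : Idx m p) :
    score (fun θ' d => complLik θ' z d) θ (y, c) a = compScore θ z c a y := by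
  simp only [score, complLik_eq]
  exact (hasDerivAt_log_dens_mul_prop hvar hprop z y c a).deriv

lemma score_obsLik {θ : Idx m p → ℝ} (hvar : ∀ g, 0 < var θ g)
    (hprop : ∀ g, 0 < prop θ g) (z : EuclideanSpace ℝ (Fin p)) (y : ℝ) (a : Idx m p) :
    score (fun θ' y => obsLik θ' z y) θ y a = meanScore θ z a y :=
  (hasDerivAt_log_obsLik hvar hprop z y a).deriv

lemma score_condLik {θ : Idx m p → ℝ} (hvar : ∀ g, 0 < var θ g)
    (hprop : ∀ g, 0 < prop θ g) (z : EuclideanSpace ℝ (Fin p)) (y : ℝ) (c : Fin (m + 1))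
    (a : Idx m p) :
    score (fun θ' d => condLik θ' z d) θ (y, c) a =
      compScore θ z c a y - meanScore θ z a y := by
  refine HasDerivAt.deriv (((hasDerivAt_log_dens_mul_prop hvar hprop z y c a).sub
    (hasDerivAt_log_obsLik hvar hprop z y a)).congr_of_eventuallyEq ?_)
  filter_upwards [eventually_all.2 fun g => eventually_var_pos hvar a g,
    eventually_all.2 fun g => eventually_prop_pos hprop a g] with t h1 h2
  simp only [condLik, complLik_eq]
  exact Real.log_div (mul_pos (dens_pos (h1 c) z y) (h2 c)).ne' (obsLik_pos h1 h2 z y).ne'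

/-- The law of the response in cluster `g`. -/
abbrev compLaw (θ : Idx m p → ℝ) (z : EuclideanSpace ℝ (Fin p)) (g : Fin (m + 1)) : Measure ℝ :=
  gaussianReal (linPred θ z g) (var θ g).toNNReal

lemma integral_obsLaw {θ : Idx m p → ℝ} (hprop : ∀ g, 0 < prop θ g)
    (z : EuclideanSpace ℝ (Fin p)) (f : ℝ → ℝ) (hf : ∀ g, Integrable f (compLaw θ z g)) :
    ∫ y, f y ∂obsLaw θ z = ∑ g, prop θ g * ∫ y, f y ∂compLaw θ z g := by
  rw [obsLaw, integral_finsetSum_measure fun g _ => (hf g).smul_measure ENNReal.ofReal_ne_top]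
  simp [integral_smul_measure, ENNReal.toReal_ofReal (hprop _).le]

lemma integral_complLaw {θ : Idx m p → ℝ} (hprop : ∀ g, 0 < prop θ g)
    (z : EuclideanSpace ℝ (Fin p)) (f : ℝ × Fin (m + 1) → ℝ)
    (hf : ∀ g, Integrable (fun y => f (y, g)) (compLaw θ z g)) :
    ∫ d, f d ∂complLaw θ z = ∑ g, prop θ g * ∫ y, f (y, g) ∂compLaw θ z g := by
  have he : ∀ g : Fin (m + 1), MeasurableEmbedding fun y : ℝ => (y, g) := fun g =>
    MeasurableEmbedding.prodMk_right MeasurableEmbedding.id g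
  rw [complLaw, integral_finsetSum_measure fun g _ =>
    ((he g).integrable_map_iff.2 (hf g)).smul_measure ENNReal.ofReal_ne_top]
  simp [integral_smul_measure, ENNReal.toReal_ofReal (hprop _).le, (he _).integral_map]

lemma integrable_compLaw_iff {θ : Idx m p → ℝ} (hvar : ∀ g, 0 < var θ g)
    (z : EuclideanSpace ℝ (Fin p)) (g : Fin (m + 1)) (f : ℝ → ℝ) :
    Integrable f (compLaw θ z g) ↔ Integrable fun y => dens θ z y g * f y := by
  rw [compLaw, gaussianReal_of_var_ne_zero _ (by simpa using hvar g),
    integrable_withDensity_iff_integrable_smul' (measurable_gaussianPDF _ _)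
      (by simp [gaussianPDF])]
  simp [dens, toReal_gaussianPDF]

/-- Turns expectations under the joint law into a single Lebesgue integral, so that identities and
bounds can be checked pointwise in y. -/
lemma sum_prop_mul_integral {θ : Idx m p → ℝ} (hvar : ∀ g, 0 < var θ g)
    (z : EuclideanSpace ℝ (Fin p)) (F : Fin (m + 1) → ℝ → ℝ)
    (hF : ∀ g, Integrable (F g) (compLaw θ z g)) :
    Integrable (fun y => ∑ g, prop θ g * dens θ z y g * F g y) ∧
    ∑ g, prop θ g * ∫ y, F g y ∂compLaw θ z g =
      ∫ y, ∑ g, prop θ g * dens θ z y g * F g y := by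
  have hi : ∀ g, Integrable fun y => prop θ g * dens θ z y g * F g y := fun g => by
    simpa [mul_assoc] using ((integrable_compLaw_iff hvar z g _).1 (hF g)).const_mul (prop θ g)
  refine ⟨integrable_finsetSum _ fun g _ => hi g, ?_⟩
  rw [integral_finsetSum _ fun g _ => hi g]
  refine Finset.sum_congr rfl fun g _ => ?_
  rw [compLaw, integral_gaussianReal_eq_integral_smul (by simpa using hvar g),
    ← integral_const_mul]
  simp [dens, mul_assoc]

lemma memLp_sub_pow_gaussianReal (c μ : ℝ) (v : NNReal) (n : ℕ) (hn : n ≤ 2) :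
    MemLp (fun y => (y - c) ^ n) 2 (gaussianReal μ v) := by
  have h1 (q : ENNReal) (hq : q ≠ ⊤) : MemLp (fun y => y - c) q (gaussianReal μ v) :=
    (memLp_id_gaussianReal' q hq).sub (memLp_const c)
  interval_cases n
  · simpa using memLp_const (μ := gaussianReal μ v) (p := 2) (1 : ℝ)
  · simpa using h1 2 (by simp)
  -- A square lies in L² as the product of two L⁴ functions.
  · have : ENNReal.HolderTriple 4 4 2 := ⟨by
      have : (4 : ENNReal)⁻¹ = 2⁻¹ * 2⁻¹ := by
        rw [← ENNReal.mul_inv (by simp) (by simp)]; norm_num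
      rw [this, ← two_mul, ← mul_assoc, ENNReal.mul_inv_cancel (by simp) (by simp), one_mul]⟩
    simpa [pow_two, Pi.mul_def] using (h1 4 (by simp)).mul (h1 4 (by simp)) (r := 2)

lemma memLp_compScore (θ : Idx m p → ℝ) (z : EuclideanSpace ℝ (Fin p)) (g : Fin (m + 1))
    (a : Idx m p) (h : Fin (m + 1)) : MemLp (compScore θ z g a) 2 (compLaw θ z h) := by
  rcases a with ⟨c, k⟩ | c | c
  · by_cases hc : c = g
    · convert (memLp_sub_pow_gaussianReal (linPred θ z g) (linPred θ z h) (var θ h).toNNReal 1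
        (by simp)).const_mul (design z k / var θ g) using 1
      ext y
      simp [compScore, hc]; ring
    · have : compScore θ z g (.inl (c, k)) = fun _ => 0 := by ext; simp [compScore, hc]
      rw [this]; exact memLp_const 0
  · by_cases hc : c = g
    · convert ((memLp_sub_pow_gaussianReal (linPred θ z g) (linPred θ z h) (var θ h).toNNReal 2
        (by simp)).const_mul (1 / (2 * var θ g ^ 2))).sub (memLp_const (1 / (2 * var θ g))) using 1
      ext y
      simp [compScore, hc]; ring
    · have : compScore θ z g (.inr (.inl c)) = fun _ => 0 := by ext; simp [compScore, hc]
      rw [this]; exact memLp_const 0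
  · exact memLp_const _

lemma measurable_compScore (θ : Idx m p → ℝ) (z : EuclideanSpace ℝ (Fin p)) (g : Fin (m + 1))
    (a : Idx m p) : Measurable (compScore θ z g a) := by
  unfold compScore
  rcases a with ⟨c, k⟩ | c | c <;> simp only <;> (try split_ifs) <;> fun_prop

lemma measurable_postProb (θ : Idx m p → ℝ) (z : EuclideanSpace ℝ (Fin p)) (g : Fin (m + 1)) :
    Measurable (postProb θ z g) := by
  have h (g) : Measurable fun y => dens θ z y g := measurable_gaussianPDFReal _ _
  unfold postProb obsLik
  fun_prop

lemma postProb_nonneg {θ : Idx m p → ℝ} (hvar : ∀ g, 0 < var θ g)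
    (hprop : ∀ g, 0 < prop θ g) (z : EuclideanSpace ℝ (Fin p)) (g : Fin (m + 1)) (y : ℝ) :
    0 ≤ postProb θ z g y :=
  div_nonneg (mul_pos (hprop g) (dens_pos (hvar g) z y)).le (obsLik_pos hvar hprop z y).le

lemma sum_postProb {θ : Idx m p → ℝ} (hvar : ∀ g, 0 < var θ g)
    (hprop : ∀ g, 0 < prop θ g) (z : EuclideanSpace ℝ (Fin p)) (y : ℝ) :
    ∑ g, postProb θ z g y = 1 := by
  simp only [postProb, ← Finset.sum_div]
  exact div_self (obsLik_pos hvar hprop z y).ne'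

lemma postProb_le_one {θ : Idx m p → ℝ} (hvar : ∀ g, 0 < var θ g)
    (hprop : ∀ g, 0 < prop θ g) (z : EuclideanSpace ℝ (Fin p)) (g : Fin (m + 1)) (y : ℝ) :
    postProb θ z g y ≤ 1 :=
  (Finset.single_le_sum (fun g _ => postProb_nonneg hvar hprop z g y) (Finset.mem_univ g)).trans_eq
    (sum_postProb hvar hprop z y)

lemma memLp_meanScore {θ : Idx m p → ℝ} (hvar : ∀ g, 0 < var θ g)
    (hprop : ∀ g, 0 < prop θ g) (z : EuclideanSpace ℝ (Fin p)) (a : Idx m p) (h : Fin (m + 1)) :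
    MemLp (meanScore θ z a) 2 (compLaw θ z h) := by
  refine memLp_finsetSum (μ := compLaw θ z h) (f := fun g y => postProb θ z g y * compScore θ z g a y)
    Finset.univ fun g _ => (memLp_compScore θ z g a h).mono
    ((measurable_postProb θ z g).mul (measurable_compScore θ z g a)).aestronglyMeasurable
    (ae_of_all _ fun y => ?_)
  rw [norm_mul, Real.norm_of_nonneg (postProb_nonneg hvar hprop z g y)]
  exact mul_le_of_le_one_left (norm_nonneg _) (postProb_le_one hvar hprop z g y)

lemma complInfo_apply {θ : Idx m p → ℝ} (hvar : ∀ g, 0 < var θ g)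
    (hprop : ∀ g, 0 < prop θ g) (z : EuclideanSpace ℝ (Fin p)) (a b : Idx m p) :
    complInfo θ z a b = ∑ g, prop θ g *
      ∫ y, compScore θ z g a y * compScore θ z g b y ∂compLaw θ z g := by
  simp only [complInfo, fisherInfo, Matrix.of_apply]
  rw [integral_complLaw hprop]
  · simp only [score_complLik hvar hprop]
  · intro g
    simp only [score_complLik hvar hprop]
    exact (memLp_compScore θ z g a g).integrable_mul (memLp_compScore θ z g b g)

lemma info_apply {θ : Idx m p → ℝ} (hvar : ∀ g, 0 < var θ g)
    (hprop : ∀ g, 0 < prop θ g) (z : EuclideanSpace ℝ (Fin p)) (a b : Idx m p) :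
    info θ z a b = ∑ g, prop θ g *
      ∫ y, meanScore θ z a y * meanScore θ z b y ∂compLaw θ z g := by
  simp only [info, fisherInfo, Matrix.of_apply]
  rw [integral_obsLaw hprop]
  · simp only [score_obsLik hvar hprop]
  · intro g
    simp only [score_obsLik hvar hprop]
    exact (memLp_meanScore hvar hprop z a g).integrable_mul (memLp_meanScore hvar hprop z b g)

lemma integrable_compScore_sub_mul {θ : Idx m p → ℝ} (hvar : ∀ g, 0 < var θ g)
    (hprop : ∀ g, 0 < prop θ g) (z : EuclideanSpace ℝ (Fin p)) (a b : Idx m p) (g : Fin (m + 1)) :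
    Integrable (fun y => (compScore θ z g a y - meanScore θ z a y) *
      (compScore θ z g b y - meanScore θ z b y)) (compLaw θ z g) :=
  ((memLp_compScore θ z g a g).sub (memLp_meanScore hvar hprop z a g)).integrable_mul
      ((memLp_compScore θ z g b g).sub (memLp_meanScore hvar hprop z b g))

lemma missInfo_apply {θ : Idx m p → ℝ} (hvar : ∀ g, 0 < var θ g)
    (hprop : ∀ g, 0 < prop θ g) (z : EuclideanSpace ℝ (Fin p)) (a b : Idx m p) :
    missInfo θ z a b = ∑ g, prop θ g *
      ∫ y, (compScore θ z g a y - meanScore θ z a y) *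
        (compScore θ z g b y - meanScore θ z b y) ∂compLaw θ z g := by
  simp only [missInfo, fisherInfo, Matrix.of_apply]
  rw [integral_complLaw hprop]
  · simp only [score_condLik hvar hprop]
  · intro g
    simp only [score_condLik hvar hprop]
    exact integrable_compScore_sub_mul hvar hprop z a b g

lemma sum_mul_compScore {θ : Idx m p → ℝ} (hvar : ∀ g, 0 < var θ g)
    (hprop : ∀ g, 0 < prop θ g) (z : EuclideanSpace ℝ (Fin p)) (a : Idx m p) (y : ℝ) :
    ∑ g, prop θ g * dens θ z y g * compScore θ z g a y = obsLik θ z y * meanScore θ z a y := by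
  simp only [meanScore, postProb, Finset.mul_sum]
  exact Finset.sum_congr rfl fun g _ => by
    have := (obsLik_pos hvar hprop z y).ne'
    field_simp

/-- The missing information principle. -/
theorem info_eq_complInfo_sub_missInfo {θ : Idx m p → ℝ} (hvar : ∀ g, 0 < var θ g)
    (hprop : ∀ g, 0 < prop θ g) (z : EuclideanSpace ℝ (Fin p)) :
    info θ z = complInfo θ z - missInfo θ z := by
  ext a b
  have h1 := sum_prop_mul_integral hvar z (fun _ y => meanScore θ z a y * meanScore θ z b y)
    fun g => (memLp_meanScore hvar hprop z a g).integrable_mul (memLp_meanScore hvar hprop z b g)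
  have h2 := sum_prop_mul_integral hvar z (fun g y => compScore θ z g a y * compScore θ z g b y)
    fun g => (memLp_compScore θ z g a g).integrable_mul (memLp_compScore θ z g b g)
  have h3 := sum_prop_mul_integral hvar z _ (integrable_compScore_sub_mul hvar hprop z a b)
  rw [Matrix.sub_apply, info_apply hvar hprop, complInfo_apply hvar hprop,
    missInfo_apply hvar hprop, h1.2, h2.2, h3.2, ← integral_sub h2.1 h3.1]
  congr 1
  ext y
  have ha := sum_mul_compScore hvar hprop z a y
  have hb := sum_mul_compScore hvar hprop z b y
  -- Expansion of the centred products; by `sum_mul_compScore` the cross terms reduce to W times the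
  -- product of the means.
  have e : ∑ g, prop θ g * dens θ z y g * (compScore θ z g a y * compScore θ z g b y) -
      ∑ g, prop θ g * dens θ z y g * ((compScore θ z g a y - meanScore θ z a y) *
        (compScore θ z g b y - meanScore θ z b y)) =
      (∑ g, prop θ g * dens θ z y g * compScore θ z g a y) * meanScore θ z b y +
      (∑ g, prop θ g * dens θ z y g * compScore θ z g b y) * meanScore θ z a y -
      (∑ g, prop θ g * dens θ z y g) * (meanScore θ z a y * meanScore θ z b y) := by
    simp only [Finset.sum_mul, ← Finset.sum_sub_distrib, ← Finset.sum_add_distrib]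
    exact Finset.sum_congr rfl fun g _ => by ring
  rw [e, ha, hb, ← Finset.sum_mul]
  simp only [obsLik]
  ring

end

/-! ### Closed form of the complete-data information -/

section

variable {m p : ℕ}

/-- Functions of the form q(t) exp(v t²/2) are stable under differentiation, so the derivatives of
the Gaussian moment generating function can be read off from the factor q. -/
lemma hasDerivAt_mul_exp_sq (v : ℝ) {q : ℝ → ℝ} {q' t : ℝ} (hq : HasDerivAt q q' t) :
    HasDerivAt (fun t => q t * Real.exp (v * t ^ 2 / 2))
      ((q' + v * t * q t) * Real.exp (v * t ^ 2 / 2)) t := by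
  have h : HasDerivAt (fun t : ℝ => v * t ^ 2 / 2) (v * t) t :=
    (((hasDerivAt_pow 2 t).const_mul v).div_const 2).congr_deriv (by simp; ring)
  exact (hq.mul h.exp).congr_deriv (by ring)

lemma integral_pow_gaussianReal_zero (v : NNReal) :
    (∫ y, y ^ 3 ∂gaussianReal 0 v = 0) ∧ (∫ y, y ^ 4 ∂gaussianReal 0 v = 3 * (v : ℝ) ^ 2) := by
  have h0 : (0 : ℝ) ∈ interior (integrableExpSet id (gaussianReal 0 v)) := by
    simp [integrableExpSet_id_gaussianReal]
  have d1 : deriv (fun t : ℝ => Real.exp (v * t ^ 2 / 2)) =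
      fun t => (v * t) * Real.exp (v * t ^ 2 / 2) := by
    ext t
    simpa using (hasDerivAt_mul_exp_sq v (hasDerivAt_const t (1 : ℝ))).deriv
  have d2 : deriv (fun t : ℝ => (v * t) * Real.exp (v * t ^ 2 / 2)) =
      fun t => (v + v ^ 2 * t ^ 2) * Real.exp (v * t ^ 2 / 2) := by
    ext t
    rw [(hasDerivAt_mul_exp_sq v ((hasDerivAt_id' t).const_mul (v : ℝ))).deriv]
    ring
  have d3 : deriv (fun t : ℝ => (v + v ^ 2 * t ^ 2) * Real.exp (v * t ^ 2 / 2)) =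
      fun t => (3 * v ^ 2 * t + v ^ 3 * t ^ 3) * Real.exp (v * t ^ 2 / 2) := by
    ext t
    rw [(hasDerivAt_mul_exp_sq v (((hasDerivAt_pow 2 t).const_mul ((v : ℝ) ^ 2)).const_add
      (v : ℝ))).deriv]
    push_cast
    ring
  have d4 : deriv (fun t : ℝ => (3 * v ^ 2 * t + v ^ 3 * t ^ 3) * Real.exp (v * t ^ 2 / 2)) 0 =
      3 * (v : ℝ) ^ 2 := by
    rw [(hasDerivAt_mul_exp_sq v (((hasDerivAt_id' (0 : ℝ)).const_mul (3 * (v : ℝ) ^ 2)).fun_add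
      ((hasDerivAt_pow 3 (0 : ℝ)).const_mul ((v : ℝ) ^ 3)))).deriv]
    simp
  have h3 := iteratedDeriv_mgf_zero h0 3
  have h4 := iteratedDeriv_mgf_zero h0 4
  simp only [mgf_id_gaussianReal, iteratedDeriv_succ, iteratedDeriv_zero, zero_mul, zero_add,
    d1, d2, d3, d4] at h3 h4
  exact ⟨by simpa using h3.symm, by simpa using h4.symm⟩

lemma integral_sub_pow_gaussianReal (μ : ℝ) (v : NNReal) (n : ℕ) :
    ∫ y, (y - μ) ^ n ∂gaussianReal μ v = ∫ y, y ^ n ∂gaussianReal 0 v := by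
  have h := gaussianReal_map_sub_const (μ := μ) (v := v) μ
  rw [sub_self] at h
  rw [← h, integral_map (by fun_prop) (by fun_prop)]

lemma integral_sub_sq_gaussianReal (μ : ℝ) (v : NNReal) :
    ∫ y, (y - μ) ^ 2 ∂gaussianReal μ v = v := by
  have h := variance_id_gaussianReal (μ := μ) (v := v)
  rw [variance_eq_integral (by fun_prop)] at h
  simpa using h

lemma integrable_sub_pow_gaussianReal (μ : ℝ) (v : NNReal) (n : ℕ) :
    Integrable (fun y => (y - μ) ^ n) (gaussianReal μ v) := by
  have h : MemLp (fun y => y - μ) n (gaussianReal μ v) :=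
    (memLp_id_gaussianReal' n (by simp)).sub (memLp_const μ)
  rcases eq_or_ne n 0 with rfl | hn
  · simp
  · refine (h.integrable_norm_pow hn).mono (by fun_prop) (ae_of_all _ fun y => by simp)

/-- Every product is a polynomial of degree at most 4 in the centred response. Coefficient-variance
products are odd. The proportion scores do not depend on y, hence the arbitrary argument 0, and
their products with the other scores integrate to 0 because those have mean 0. -/
lemma integral_compScore_mul {θ : Idx m p → ℝ} (hvar : ∀ g, 0 < var θ g)
    (z : EuclideanSpace ℝ (Fin p)) (g : Fin (m + 1)) (a b : Idx m p) :
    ∫ y, compScore θ z g a y * compScore θ z g b y ∂compLaw θ z g =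
    match a, b with
    | .inl (c, k), .inl (d, l) =>
        if c = g ∧ d = g then design z k * design z l / var θ g else 0
    | .inr (.inl c), .inr (.inl d) => if c = g ∧ d = g then 1 / (2 * var θ g ^ 2) else 0
    | .inr (.inr c), .inr (.inr d) =>
        compScore θ z g (.inr (.inr c)) 0 * compScore θ z g (.inr (.inr d)) 0
    | _, _ => 0 := by
  have hv : ((var θ g).toNNReal : ℝ) = var θ g := Real.coe_toNNReal _ (hvar g).le
  have hv0 := (hvar g).ne'
  have i1 : ∫ y, (y - linPred θ z g) ∂compLaw θ z g = 0 := by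
    rw [integral_sub (by exact (memLp_id_gaussianReal 1).integrable (by simp))
      (integrable_const _)]
    simp
  have i2 : ∫ y, (y - linPred θ z g) ^ 2 ∂compLaw θ z g = var θ g := by
    rw [integral_sub_sq_gaussianReal, hv]
  have i3 : ∫ y, (y - linPred θ z g) ^ 3 ∂compLaw θ z g = 0 := by
    rw [integral_sub_pow_gaussianReal, (integral_pow_gaussianReal_zero _).1]
  have i4 : ∫ y, (y - linPred θ z g) ^ 4 ∂compLaw θ z g = 3 * var θ g ^ 2 := by
    rw [integral_sub_pow_gaussianReal, (integral_pow_gaussianReal_zero _).2, hv]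
  have I (n) : Integrable (fun y => (y - linPred θ z g) ^ n) (compLaw θ z g) :=
    integrable_sub_pow_gaussianReal _ _ n
  have poly (c0 c1 c2 c3 c4 : ℝ) : ∫ y, (c0 + c1 * (y - linPred θ z g) ^ 1 +
      c2 * (y - linPred θ z g) ^ 2 + c3 * (y - linPred θ z g) ^ 3 +
      c4 * (y - linPred θ z g) ^ 4) ∂compLaw θ z g =
      c0 + c2 * var θ g + c4 * (3 * var θ g ^ 2) := by
    have J (n) (c : ℝ) : Integrable (fun y => c * (y - linPred θ z g) ^ n) (compLaw θ z g) :=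
      (I n).const_mul c
    have K : Integrable (fun _ : ℝ => c0) (compLaw θ z g) := integrable_const _
    rw [integral_add (by fun_prop) (J 4 c4), integral_add (by fun_prop) (J 3 c3),
      integral_add (by fun_prop) (J 2 c2), integral_add K (J 1 c1)]
    simp only [integral_const_mul, pow_one, i1, i2, i3, i4]
    simp
  have use (c0 c1 c2 c3 c4 : ℝ) (f : ℝ → ℝ) (hf : ∀ y, f y = c0 + c1 * (y - linPred θ z g) ^ 1 +
      c2 * (y - linPred θ z g) ^ 2 + c3 * (y - linPred θ z g) ^ 3 +
      c4 * (y - linPred θ z g) ^ 4) (R : ℝ) (hR : R = c0 + c2 * var θ g + c4 * (3 * var θ g ^ 2)) :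
      ∫ y, f y ∂compLaw θ z g = R := by
    rw [hR, ← poly c0 c1 c2 c3 c4]
    exact integral_congr_ae (ae_of_all _ hf)
  rcases a with ⟨c, k⟩ | c | c <;> rcases b with ⟨d, l⟩ | d | d
  · by_cases hc : c = g
    · by_cases hd : d = g
      · simp only [compScore, hc, hd]
        exact use 0 0 (design z k * design z l / var θ g ^ 2) 0 0 _ (fun y => by simp; ring) _
          (by simp; field_simp)
      · simp [compScore, hd]
    · simp [compScore, hc]
  · by_cases hc : c = g
    · by_cases hd : d = g
      · simp only [compScore, hc, hd]
        exact use 0 (-(design z k / (2 * var θ g ^ 2))) 0 (design z k / (2 * var θ g ^ 3)) 0 _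
          (fun y => by simp; field_simp; ring) _ (by simp)
      · simp [compScore, hd]
    · simp [compScore, hc]
  · by_cases hc : c = g
    · refine use 0 (design z k / var θ g * compScore θ z g (.inr (.inr d)) 0) 0 0 0 _
        (fun y => ?_) _ (by simp)
      simp only [compScore, hc]; simp; ring
    · simp [compScore, hc]
  · by_cases hc : c = g
    · by_cases hd : d = g
      · simp only [compScore, hc, hd]
        exact use 0 (-(design z l / (2 * var θ g ^ 2))) 0 (design z l / (2 * var θ g ^ 3)) 0 _
          (fun y => by simp; field_simp; ring) _ (by simp)
      · simp [compScore, hd]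
    · simp [compScore, hc]
  · by_cases hc : c = g
    · by_cases hd : d = g
      · simp only [compScore, hc, hd]
        exact use (1 / (4 * var θ g ^ 2)) 0 (-(1 / (2 * var θ g ^ 3))) 0 (1 / (4 * var θ g ^ 4)) _
          (fun y => by simp; field_simp; ring) _ (by simp; field_simp; ring)
      · simp [compScore, hd]
    · simp [compScore, hc]
  · by_cases hc : c = g
    · refine use (-(1 / (2 * var θ g)) * compScore θ z g (.inr (.inr d)) 0) 0
        (1 / (2 * var θ g ^ 2) * compScore θ z g (.inr (.inr d)) 0) 0 0 _
        (fun y => ?_) _ (by field_simp; ring)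
      simp only [compScore, hc]; simp; ring
    · simp [compScore, hc]
  · by_cases hd : d = g
    · refine use 0 (design z l / var θ g * compScore θ z g (.inr (.inr c)) 0) 0 0 0 _
        (fun y => ?_) _ (by simp)
      simp only [compScore, hd]; simp; ring
    · simp [compScore, hd]
  · by_cases hd : d = g
    · refine use (-(1 / (2 * var θ g)) * compScore θ z g (.inr (.inr c)) 0) 0
        (1 / (2 * var θ g ^ 2) * compScore θ z g (.inr (.inr c)) 0) 0 0 _
        (fun y => ?_) _ (by field_simp; ring)
      simp only [compScore, hd]; simp; ring
    · simp [compScore, hd]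
  · simp [compScore]

theorem complInfo_eq_closedForm {θ : Idx m p → ℝ} (hvar : ∀ g, 0 < var θ g)
    (hprop : ∀ g, 0 < prop θ g) (z : EuclideanSpace ℝ (Fin p)) :
    complInfo θ z = closedForm θ z := by
  ext a b
  rw [complInfo_apply hvar hprop]
  simp only [integral_compScore_mul hvar]
  rcases a with ⟨c, k⟩ | c | c <;> rcases b with ⟨d, l⟩ | d | d <;>
    simp only [closedForm, Matrix.of_apply, mul_zero, Finset.sum_const_zero]
  · by_cases h : c = d
    · subst h
      simp [mul_div_assoc]
    · have : ∀ g, ¬ (c = g ∧ d = g) := fun g hg => h (hg.1.trans hg.2.symm)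
      simp [h, this]
  · by_cases h : c = d
    · subst h
      simp [div_eq_mul_inv]
    · have : ∀ g, ¬ (c = g ∧ d = g) := fun g hg => h (hg.1.trans hg.2.symm)
      simp [h, this]
  · have hl := (hprop (Fin.last m)).ne'
    have hg := fun g : Fin m => (hprop g.castSucc).ne'
    -- The last cluster alone produces the term 1/π_G common to all entries of the proportion block.
    rw [Fin.sum_univ_castSucc]
    simp only [compScore, Fin.castSucc_ne_last, Fin.castSucc_inj, if_false, sub_zero, if_true,
      zero_sub, neg_mul_neg]
    congr 1
    · by_cases h : c = d
      · subst h
        simp [hg]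
      · simp [h]
    · field_simp

end

/-! ### Bounding the missing information by the separation of the clusters -/

section

variable {m p : ℕ}

/-- A bound, up to a constant factor, for the missing information: it is small where the linear
predictors of the clusters are well separated relative to the size of the covariates. -/
def sepBound (θ : Idx m p → ℝ) (κ : ℝ) (z : EuclideanSpace ℝ (Fin p)) : ℝ :=
  ∑ q ∈ (Finset.univ : Finset (Fin (m + 1))).offDiag,
    (1 + ‖z‖ ^ 2) * Real.exp (-κ * (linPred θ z q.1 - linPred θ z q.2) ^ 2)

lemma measurable_sepBound (θ : Idx m p → ℝ) (κ : ℝ) : Measurable (sepBound θ κ) := by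
  have h (a : Fin (p + 1)) : Measurable fun z : EuclideanSpace ℝ (Fin p) => design z a := by
    cases a using Fin.cases <;> simp only [design, Fin.cons_zero, Fin.cons_succ] <;> fun_prop
  unfold sepBound linPred
  fun_prop

lemma sq_design_le (z : EuclideanSpace ℝ (Fin p)) (k : Fin (p + 1)) :
    design z k ^ 2 ≤ 1 + ‖z‖ ^ 2 := by
  cases k using Fin.cases with
  | zero => simp [design]
  | succ l =>
    have h : |z l| ≤ ‖z‖ := by simpa using PiLp.norm_apply_le z l
    simp only [design, Fin.cons_succ]
    nlinarith [sq_abs (z l), abs_nonneg (z l)]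

lemma exists_sq_compScore_le {θ : Idx m p → ℝ} (hvar : ∀ g, 0 < var θ g) :
    ∃ K, 0 ≤ K ∧ ∀ z y g a, compScore θ z g a y ^ 2 ≤
      K * ((1 + ‖z‖ ^ 2) * (1 + (y - linPred θ z g) ^ 2) ^ 2) := by
  have key : ∀ q : Fin (m + 1) × Idx m p, ∃ K, 0 ≤ K ∧ ∀ z y, compScore θ z q.1 q.2 y ^ 2 ≤
      K * ((1 + ‖z‖ ^ 2) * (1 + (y - linPred θ z q.1) ^ 2) ^ 2) := by
    rintro ⟨g, a⟩
    have hv := hvar g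
    have h1 (z : EuclideanSpace ℝ (Fin p)) : 1 ≤ 1 + ‖z‖ ^ 2 := by simp
    have h2 (D : ℝ) : 1 ≤ (1 + D ^ 2) ^ 2 := by nlinarith [sq_nonneg D]
    rcases a with ⟨c, k⟩ | c | c
    · refine ⟨1 / var θ g ^ 2, by positivity, fun z y => ?_⟩
      by_cases hc : c = g
      · simp only [compScore, hc, if_true]
        set D := y - linPred θ z g
        have h3 : D ^ 2 ≤ (1 + D ^ 2) ^ 2 := by nlinarith [sq_nonneg D]
        calc (design z k * D / var θ g) ^ 2 = 1 / var θ g ^ 2 * (design z k ^ 2 * D ^ 2) := by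
              ring
          _ ≤ _ := by gcongr; exact sq_design_le z k
      · simp only [compScore, hc, if_false]; rw [zero_pow two_ne_zero]; positivity
    · refine ⟨(1 / (2 * var θ g ^ 2) + 1 / (2 * var θ g)) ^ 2, by positivity, fun z y => ?_⟩
      by_cases hc : c = g
      · simp only [compScore, hc, if_true]
        set D := y - linPred θ z g
        have h4 : (D ^ 2 / (2 * var θ g ^ 2) - 1 / (2 * var θ g)) ^ 2 ≤
            ((1 / (2 * var θ g ^ 2) + 1 / (2 * var θ g)) * (1 + D ^ 2)) ^ 2 := by
          rw [sq_le_sq, abs_of_nonneg (by positivity : 0 ≤ (1 / (2 * var θ g ^ 2) +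
            1 / (2 * var θ g)) * (1 + D ^ 2)), abs_le]
          have e : D ^ 2 / (2 * var θ g ^ 2) = 1 / (2 * var θ g ^ 2) * D ^ 2 := by ring
          rw [e]
          have p1 : 0 ≤ 1 / (2 * var θ g ^ 2) := by positivity
          have p2 : 0 ≤ 1 / (2 * var θ g) := by positivity
          constructor <;> nlinarith [mul_nonneg p1 (sq_nonneg D), mul_nonneg p2 (sq_nonneg D)]
        refine h4.trans ?_
        rw [mul_pow]
        gcongr
        exact le_mul_of_one_le_left (by positivity) (h1 z)
      · simp only [compScore, hc, if_false]; rw [zero_pow two_ne_zero]; positivity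
    · refine ⟨compScore θ 0 g (.inr (.inr c)) 0 ^ 2, by positivity, fun z y => ?_⟩
      refine le_mul_of_one_le_right (by positivity) ?_
      exact one_le_mul_of_one_le_of_one_le (h1 z) (h2 _)
  choose K hK0 hK using key
  -- The sum of the finitely many constants dominates each of them.
  refine ⟨∑ q, K q, Finset.sum_nonneg fun q _ => hK0 q, fun z y g a => (hK (g, a) z y).trans ?_⟩
  gcongr
  exact Finset.single_le_sum (fun q _ => hK0 q) (Finset.mem_univ (g, a))

lemma exists_prop_mul_dens_le {θ : Idx m p → ℝ} (hvar : ∀ g, 0 < var θ g)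
    (hprop : ∀ g, 0 < prop θ g) {V : ℝ} (hV : ∀ g, var θ g ≤ V) :
    ∃ K, 0 ≤ K ∧ ∀ z y g, prop θ g * dens θ z y g ≤
      K * Real.exp (-(y - linPred θ z g) ^ 2 / (2 * V)) := by
  have hpos (g) : 0 ≤ prop θ g * (√(2 * Real.pi * var θ g))⁻¹ :=
    mul_nonneg (hprop g).le (by positivity)
  refine ⟨∑ g, prop θ g * (√(2 * Real.pi * var θ g))⁻¹, Finset.sum_nonneg fun g _ => hpos g,
    fun z y g => ?_⟩
  rw [dens_eq (hvar g), ← mul_assoc]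
  have hv := hvar g
  refine mul_le_mul (Finset.single_le_sum (fun g _ => hpos g) (Finset.mem_univ g))
    (Real.exp_le_exp.2 ?_) (Real.exp_pos _).le (Finset.sum_nonneg fun g _ => hpos g)
  rw [neg_div, neg_div, neg_le_neg_iff]
  have := hV g
  gcongr

/-- From x²/2 ≤ exp x at x = (1 + t)/(8V). It absorbs the polynomial growth of the scores at the
cost of half of the exponent t/(4V). -/
lemma one_add_sq_le_exp {V t : ℝ} (hV : 0 < V) (ht : 0 ≤ t) :
    (1 + t) ^ 2 ≤ 2 * (8 * V) ^ 2 * Real.exp (1 / (8 * V)) * Real.exp (t / (8 * V)) := by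
  have h := Real.pow_div_factorial_le_exp ((1 + t) / (8 * V)) (by positivity) 2
  rw [add_div, Real.exp_add, ← add_div, div_pow] at h
  have h8 : 0 < (8 * V) ^ 2 := by positivity
  simp only [Nat.factorial, Nat.succ_eq_add_one, zero_add, Nat.mul_one] at h
  rw [div_div, div_le_iff₀ (by positivity)] at h
  calc (1 + t) ^ 2 ≤ _ := h
    _ = _ := by push_cast; ring

/-- Since x y ≤ W², the quotient is at most the geometric mean √(x y), hence at most B. -/
lemma mul_div_le_of_mul_le_sq {x y W B : ℝ} (hx : 0 ≤ x) (hy : 0 ≤ y) (hW : 0 < W) (hxW : x ≤ W)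
    (hyW : y ≤ W) (hB : 0 ≤ B) (h : x * y ≤ B ^ 2) : x * y / W ≤ B := by
  refine (le_abs_self _).trans (abs_le_of_sq_le_sq ?_ hB)
  rw [div_pow, div_le_iff₀ (by positivity)]
  calc (x * y) ^ 2 = (x * y) * (x * y) := by ring
    _ ≤ B ^ 2 * (W * W) := by gcongr
    _ = _ := by ring

/-- The sum of the squared residuals of `y` in the clusters `g` and `h`. -/
def resSq (θ : Idx m p → ℝ) (z : EuclideanSpace ℝ (Fin p)) (q : Fin (m + 1) × Fin (m + 1))
    (y : ℝ) : ℝ :=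
  (y - linPred θ z q.1) ^ 2 + (y - linPred θ z q.2) ^ 2

/-- The geometric mean of the two weights decays like exp(-A/(4V)), with A the sum of the squared
residuals, while the scores grow polynomially in A. The constant does not depend on z or y. -/
lemma exists_pair_le {θ : Idx m p → ℝ} (hvar : ∀ g, 0 < var θ g)
    (hprop : ∀ g, 0 < prop θ g) {V : ℝ} (hV : ∀ g, var θ g ≤ V) :
    ∃ C, 0 ≤ C ∧ ∀ z y a (q : Fin (m + 1) × Fin (m + 1)),
      prop θ q.1 * dens θ z y q.1 * postProb θ z q.2 y *
        (compScore θ z q.1 a y - compScore θ z q.2 a y) ^ 2 ≤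
      C * ((1 + ‖z‖ ^ 2) * Real.exp (-resSq θ z q y / (8 * V))) := by
  obtain ⟨K, hK0, hK⟩ := exists_sq_compScore_le hvar
  obtain ⟨L, hL0, hL⟩ := exists_prop_mul_dens_le hvar hprop hV
  have hV0 : 0 < V := (hvar 0).trans_le (hV 0)
  set E := 2 * (8 * V) ^ 2 * Real.exp (1 / (8 * V)) with hE
  refine ⟨L * (4 * K * E), by positivity, fun z y a ⟨g, h⟩ => ?_⟩
  simp only
  set A := resSq θ z (g, h) y with hA
  have hAe : A = (y - linPred θ z g) ^ 2 + (y - linPred θ z h) ^ 2 := rfl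
  have hA0 : 0 ≤ A := by rw [hAe]; positivity
  have hw (g) : 0 < prop θ g * dens θ z y g := mul_pos (hprop g) (dens_pos (hvar g) z y)
  have hle (g) : prop θ g * dens θ z y g ≤ obsLik θ z y :=
    Finset.single_le_sum (f := fun g => prop θ g * dens θ z y g)
      (fun g _ => (hw g).le) (Finset.mem_univ g)
  have h1 : prop θ g * dens θ z y g * postProb θ z h y ≤ L * Real.exp (-A / (4 * V)) := by
    rw [postProb, ← mul_div_assoc]
    refine mul_div_le_of_mul_le_sq (hw g).le (hw h).le (obsLik_pos hvar hprop z y) (hle g) (hle h)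
      (by positivity) ?_
    calc _ ≤ (L * Real.exp (-(y - linPred θ z g) ^ 2 / (2 * V))) *
          (L * Real.exp (-(y - linPred θ z h) ^ 2 / (2 * V))) :=
          mul_le_mul (hL z y g) (hL z y h) (hw h).le (by positivity)
      _ = L ^ 2 * (Real.exp (-(y - linPred θ z g) ^ 2 / (2 * V)) *
          Real.exp (-(y - linPred θ z h) ^ 2 / (2 * V))) := by ring
      _ = _ := by
        rw [mul_pow, ← Real.exp_add, ← Real.exp_nat_mul, hAe]
        congr 2
        field_simp
        push_cast
        ring
  have h2 : (compScore θ z g a y - compScore θ z h a y) ^ 2 ≤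
      4 * K * ((1 + ‖z‖ ^ 2) * (1 + A) ^ 2) := by
    have b1 : compScore θ z g a y ^ 2 ≤ K * ((1 + ‖z‖ ^ 2) * (1 + A) ^ 2) :=
      (hK z y g a).trans (by gcongr; rw [hAe]; nlinarith [sq_nonneg (y - linPred θ z h)])
    have b2 : compScore θ z h a y ^ 2 ≤ K * ((1 + ‖z‖ ^ 2) * (1 + A) ^ 2) :=
      (hK z y h a).trans (by gcongr; rw [hAe]; nlinarith [sq_nonneg (y - linPred θ z g)])
    nlinarith [sq_nonneg (compScore θ z g a y + compScore θ z h a y)]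
  calc _ ≤ L * Real.exp (-A / (4 * V)) * (4 * K * ((1 + ‖z‖ ^ 2) *
        (E * Real.exp (A / (8 * V))))) := by
        gcongr
        refine h2.trans ?_
        gcongr
        exact one_add_sq_le_exp hV0 hA0
    _ = L * (4 * K * E) * ((1 + ‖z‖ ^ 2) *
        (Real.exp (-A / (4 * V)) * Real.exp (A / (8 * V)))) := by ring
    _ = _ := by
      rw [← Real.exp_add]
      congr 3
      field_simp
      ring

/-- By the parallelogram identity, (y - a)² + (y - b)² = 2 (y - c)² + (a - b)²/2 with c the midpoint
of a and b; translation invariance removes c. -/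
lemma integral_exp_resSq {V : ℝ} (hV : 0 < V) (θ : Idx m p → ℝ)
    (z : EuclideanSpace ℝ (Fin p)) (q : Fin (m + 1) × Fin (m + 1)) :
    Integrable (fun y => Real.exp (-resSq θ z q y / (8 * V))) ∧
    ∫ y, Real.exp (-resSq θ z q y / (8 * V)) =
      (∫ y, Real.exp (-(1 / (4 * V)) * y ^ 2)) *
        Real.exp (-(1 / (16 * V)) * (linPred θ z q.1 - linPred θ z q.2) ^ 2) := by
  set c := (linPred θ z q.1 + linPred θ z q.2) / 2 with hc
  have e : (fun y => Real.exp (-resSq θ z q y / (8 * V))) = fun y =>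
      Real.exp (-(1 / (4 * V)) * (y - c) ^ 2) *
        Real.exp (-(1 / (16 * V)) * (linPred θ z q.1 - linPred θ z q.2) ^ 2) := by
    ext y
    rw [← Real.exp_add]
    congr 1
    simp only [resSq, hc]
    field_simp
    ring
  have hi : Integrable fun y : ℝ => Real.exp (-(1 / (4 * V)) * y ^ 2) :=
    integrable_exp_neg_mul_sq (by positivity)
  rw [e]
  refine ⟨(hi.comp_sub_right c).mul_const _, ?_⟩
  rw [integral_mul_const, integral_sub_right_eq_self fun y => Real.exp (-(1 / (4 * V)) * y ^ 2)]

/-- Jensen's inequality for the posterior average of s_g - s_h over h; the diagonal terms vanish. -/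
lemma sum_mul_sq_sub_meanScore_le {θ : Idx m p → ℝ} (hvar : ∀ g, 0 < var θ g)
    (hprop : ∀ g, 0 < prop θ g) (z : EuclideanSpace ℝ (Fin p)) (y : ℝ) (a : Idx m p) :
    ∑ g, prop θ g * dens θ z y g * (compScore θ z g a y - meanScore θ z a y) ^ 2 ≤
      ∑ q ∈ (Finset.univ : Finset (Fin (m + 1))).offDiag,
        prop θ q.1 * dens θ z y q.1 * postProb θ z q.2 y *
          (compScore θ z q.1 a y - compScore θ z q.2 a y) ^ 2 := by
  have h1 (g) : (compScore θ z g a y - meanScore θ z a y) ^ 2 ≤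
      ∑ h, postProb θ z h y * (compScore θ z g a y - compScore θ z h a y) ^ 2 := by
    have e : compScore θ z g a y - meanScore θ z a y =
        ∑ h, postProb θ z h y * (compScore θ z g a y - compScore θ z h a y) := by
      simp only [mul_sub, Finset.sum_sub_distrib, ← Finset.sum_mul, sum_postProb hvar hprop,
        one_mul, meanScore]
    rw [e]
    exact Real.pow_arith_mean_le_arith_mean_pow_of_even _ _ _
      (fun h _ => postProb_nonneg hvar hprop z h y) (sum_postProb hvar hprop z y) even_two
  calc _ ≤ ∑ g, prop θ g * dens θ z y g *
        ∑ h, postProb θ z h y * (compScore θ z g a y - compScore θ z h a y) ^ 2 := by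
        gcongr with g
        · exact (mul_pos (hprop g) (dens_pos (hvar g) z y)).le
        · exact h1 g
    _ = ∑ q ∈ (Finset.univ ×ˢ Finset.univ : Finset (Fin (m + 1) × Fin (m + 1))),
        prop θ q.1 * dens θ z y q.1 * postProb θ z q.2 y *
          (compScore θ z q.1 a y - compScore θ z q.2 a y) ^ 2 := by
      rw [Finset.sum_product]
      simp only [Finset.mul_sum, mul_assoc]
    _ = _ := by
      refine (Finset.sum_subset (by simp) fun q _ hq => ?_).symm
      have : q.1 = q.2 := by simpa using hq
      simp [this]

/-- Off-diagonal entries reduce to diagonal ones by |s t| ≤ (s² + t²)/2; the pairwise bounds are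
then integrated over y. -/
theorem exists_missInfo_le {θ : Idx m p → ℝ} (hvar : ∀ g, 0 < var θ g)
    (hprop : ∀ g, 0 < prop θ g) :
    ∃ C κ, 0 ≤ C ∧ 0 < κ ∧ ∀ z a b, |missInfo θ z a b| ≤ C * sepBound θ κ z := by
  set V := ∑ g, var θ g with hVdef
  have hV (g) : var θ g ≤ V := Finset.single_le_sum (fun g _ => (hvar g).le) (Finset.mem_univ g)
  have hV0 : 0 < V := (hvar 0).trans_le (hV 0)
  obtain ⟨C, hC0, hC⟩ := exists_pair_le hvar hprop hV
  set J := ∫ y, Real.exp (-(1 / (4 * V)) * y ^ 2)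
  refine ⟨C * J, 1 / (16 * V), mul_nonneg hC0 (integral_nonneg fun y => (Real.exp_pos _).le),
    by positivity, fun z a b => ?_⟩
  clear_value V
  have hint := sum_prop_mul_integral hvar z _ (integrable_compScore_sub_mul hvar hprop z a b)
  rw [missInfo_apply hvar hprop, hint.2]
  set B : ℝ → ℝ := fun y => ∑ q ∈ (Finset.univ : Finset (Fin (m + 1))).offDiag,
    C * ((1 + ‖z‖ ^ 2) * Real.exp (-resSq θ z q y / (8 * V))) with hB
  have hBi (q) : Integrable fun y => C * ((1 + ‖z‖ ^ 2) *
      Real.exp (-resSq θ z q y / (8 * V))) :=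
    ((integral_exp_resSq hV0 θ z q).1.const_mul _).const_mul _
  have hsq (y) (a) : ∑ g, prop θ g * dens θ z y g *
      (compScore θ z g a y - meanScore θ z a y) ^ 2 ≤ B y :=
    (sum_mul_sq_sub_meanScore_le hvar hprop z y a).trans
      (Finset.sum_le_sum fun q _ => hC z y a q)
  have hle : |∫ y, ∑ g, prop θ g * dens θ z y g * ((compScore θ z g a y - meanScore θ z a y) *
      (compScore θ z g b y - meanScore θ z b y))| ≤ ∫ y, B y := by
    rw [← Real.norm_eq_abs]
    refine norm_integral_le_of_norm_le (integrable_finsetSum _ fun q _ => hBi q)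
      (ae_of_all _ fun y => ?_)
    rw [Real.norm_eq_abs]
    refine (Finset.abs_sum_le_sum_abs _ _).trans ?_
    have ha := hsq y a
    have hb := hsq y b
    have : ∑ g, |prop θ g * dens θ z y g * ((compScore θ z g a y - meanScore θ z a y) *
        (compScore θ z g b y - meanScore θ z b y))| ≤
        ∑ g, (prop θ g * dens θ z y g * (compScore θ z g a y - meanScore θ z a y) ^ 2 / 2 +
          prop θ g * dens θ z y g * (compScore θ z g b y - meanScore θ z b y) ^ 2 / 2) := by
      refine Finset.sum_le_sum fun g _ => ?_
      have hw : 0 ≤ prop θ g * dens θ z y g := (mul_pos (hprop g) (dens_pos (hvar g) z y)).le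
      rw [abs_mul, abs_of_nonneg hw, mul_div_assoc, mul_div_assoc, ← mul_add]
      refine mul_le_mul_of_nonneg_left ?_ hw
      rw [abs_le]
      constructor <;>
        nlinarith [sq_nonneg (compScore θ z g a y - meanScore θ z a y +
            (compScore θ z g b y - meanScore θ z b y)),
          sq_nonneg (compScore θ z g a y - meanScore θ z a y -
            (compScore θ z g b y - meanScore θ z b y))]
    rw [Finset.sum_add_distrib, ← Finset.sum_div, ← Finset.sum_div] at this
    linarith
  refine hle.trans_eq ?_
  rw [hB, integral_finsetSum _ fun q _ => hBi q, sepBound, Finset.mul_sum]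
  refine Finset.sum_congr rfl fun q _ => ?_
  rw [integral_const_mul, integral_const_mul, (integral_exp_resSq hV0 θ z q).2]
  ring

end

/-! ### Ranks of the selected points -/

section

variable {m p : ℕ}

/-- The number of predecessors is strictly increasing along `R`, so it maps these elements
injectively into `Finset.range r`. -/
lemma card_filter_card_lt_le {α : Type*} (S : Finset α) (R : α → α → Prop) [IsStrictTotalOrder α R]
    (r : ℕ) [∀ i, DecidablePred fun k => R k i]
    [DecidablePred fun i => (S.filter fun k => R k i).card < r] :
    (S.filter fun i => (S.filter fun k => R k i).card < r).card ≤ r := by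
  have hlt : ∀ i ∈ S, ∀ k, R i k →
      (S.filter fun l => R l i).card < (S.filter fun l => R l k).card := by
    intro i hi k hik
    refine Finset.card_lt_card ⟨fun l hl => ?_, fun hsub => ?_⟩
    · rw [Finset.mem_filter] at hl ⊢
      exact ⟨hl.1, _root_.trans hl.2 hik⟩
    · have := hsub (Finset.mem_filter.2 ⟨hi, hik⟩)
      exact irrefl i (Finset.mem_filter.1 this).2
  refine (Finset.card_le_card_of_injOn (t := Finset.range r)
    (fun i => (S.filter fun k => R k i).card) (fun i hi => ?_) fun i hi k hk hik => ?_).trans_eq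
    (Finset.card_range r)
  · simpa using (Finset.mem_filter.1 hi).2
  · have hi' := (Finset.mem_filter.1 hi).1
    have hk' := (Finset.mem_filter.1 hk).1
    rcases trichotomous_of R i k with h | h | h
    · exact absurd hik (hlt i hi' k h).ne
    · exact h
    · exact absurd hik (hlt k hk' i h).ne'

lemma isStrictTotalOrder_of_value (v : ℕ → ℝ) :
    IsStrictTotalOrder ℕ fun k i => v k < v i ∨ (v k = v i ∧ k < i) where
  irrefl i := by simp
  trans a b c := by
    rintro (h | ⟨h, h'⟩) (g | ⟨g, g'⟩)
    · exact .inl (h.trans g)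
    · exact .inl (g ▸ h)
    · exact .inl (h ▸ g)
    · exact .inr ⟨h.trans g, h'.trans g'⟩
  trichotomous a b hab hba := by
    rw [not_or] at hab hba
    have e : v a = v b := le_antisymm (not_lt.1 hba.1) (not_lt.1 hab.1)
    exact le_antisymm (not_lt.1 fun h => hba.2 ⟨e.symm, h⟩) (not_lt.1 fun h => hab.2 ⟨e, h⟩)

lemma isStrictTotalOrder_of_value_swap (v : ℕ → ℝ) :
    IsStrictTotalOrder ℕ fun k i => v i < v k ∨ (v k = v i ∧ i < k) := by
  have := isStrictTotalOrder_of_value v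
  have e : (fun k i => v i < v k ∨ (v k = v i ∧ i < k)) =
      Function.swap fun k i => v k < v i ∨ (v k = v i ∧ k < i) := by
    ext k i
    simp [Function.swap, eq_comm]
  rw [e]
  infer_instance

lemma card_extremes_le (r : ℕ) (v : ℕ → ℝ) (S : Finset ℕ) : (extremes r v S).card ≤ 2 * r := by
  classical
  have := isStrictTotalOrder_of_value v
  have := isStrictTotalOrder_of_value_swap v
  rw [extremes, Finset.filter_or, two_mul]
  refine (Finset.card_union_le _ _).trans (add_le_add ?_ ?_)
  · exact card_filter_card_lt_le S (fun k i => v k < v i ∨ (v k = v i ∧ k < i)) r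
  · exact card_filter_card_lt_le S (fun k i => v i < v k ∨ (v k = v i ∧ i < k)) r

lemma card_range_filter_lt {N s : ℕ} {D : Finset ℕ} {A B : ℕ → Prop} [DecidablePred A]
    [DecidablePred B] (hAB : ∀ k, A k → B k)
    (h : ((Finset.range N \ D).filter B).card < s) :
    ((Finset.range N).filter A).card < s + D.card := by
  have : (Finset.range N).filter A ⊆ (Finset.range N \ D).filter B ∪ D := fun k hk => by
    by_cases hD : k ∈ D <;> simp_all
  have := (Finset.card_le_card this).trans (Finset.card_union_le _ _)
  omega

lemma mem_extremes_range_sdiff {r N i : ℕ} {v : ℕ → ℝ} {D : Finset ℕ}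
    (hi : i ∈ extremes r v (Finset.range N \ D)) :
    i < N ∧ (((Finset.range N).filter fun k => v k < v i).card < r + D.card ∨
      ((Finset.range N).filter fun k => v i < v k).card < r + D.card) := by
  classical
  rw [extremes, Finset.mem_filter, Finset.mem_sdiff, Finset.mem_range] at hi
  refine ⟨hi.1.1, hi.2.imp (fun h => ?_) fun h => ?_⟩ <;>
  exact card_range_filter_lt (fun k hk => Or.inl hk) h

/-- Ranks are taken among the points still available; ranks in the whole sample exceed them by at
most the number of points already removed, which the first part bounds. Dropping the tied points
only lowers the counts. -/
lemma foldl_extremes (r N : ℕ) (z : ℕ → EuclideanSpace ℝ (Fin p)) (l : List (Fin p))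
    (D : Finset ℕ) :
    (l.foldl (fun D j => D ∪ extremes r (fun i => z i j) (Finset.range N \ D)) D).card ≤
      D.card + 2 * r * l.length ∧
    ∀ i ∈ l.foldl (fun D j => D ∪ extremes r (fun i => z i j) (Finset.range N \ D)) D, i ∈ D ∨
      i < N ∧ ∃ j,
        ((Finset.range N).filter fun k => z k j < z i j).card < r + (D.card + 2 * r * l.length) ∨
        ((Finset.range N).filter fun k => z i j < z k j).card <
          r + (D.card + 2 * r * l.length) := by
  induction l generalizing D with
  | nil => exact ⟨by simp, fun i hi => .inl hi⟩
  | cons j l ih =>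
    set D' := D ∪ extremes r (fun i => z i j) (Finset.range N \ D) with hD'
    have hcard : D'.card ≤ D.card + 2 * r :=
      (Finset.card_union_le _ _).trans (by gcongr; exact card_extremes_le _ _ _)
    have hle : D'.card + 2 * r * l.length ≤ D.card + 2 * r * (j :: l).length := by
      rw [List.length_cons]; nlinarith
    rw [List.foldl_cons]
    refine ⟨(ih D').1.trans hle, fun i hi => ?_⟩
    rcases (ih D').2 i hi with h | ⟨h, k, hk⟩
    · rw [hD', Finset.mem_union] at h
      refine h.imp_right fun h => ?_
      obtain ⟨h1, h2⟩ := mem_extremes_range_sdiff h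
      exact ⟨h1, j, h2.imp (fun h => h.trans_le (by simp)) fun h => h.trans_le (by simp)⟩
    · exact .inr ⟨h, k, hk.imp (fun h => h.trans_le (by gcongr)) fun h => h.trans_le (by gcongr)⟩

lemma card_iboss_le (r N : ℕ) (z : ℕ → EuclideanSpace ℝ (Fin p)) :
    (iboss r N z).card ≤ 2 * r * p := by
  simpa [iboss] using (foldl_extremes r N z (List.finRange p) ∅).1

lemma mem_iboss {r N i : ℕ} {z : ℕ → EuclideanSpace ℝ (Fin p)} (hi : i ∈ iboss r N z) :
    i < N ∧ ∃ j,
      ((Finset.range N).filter fun k => z k j < z i j).card < r + 2 * r * p ∨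
      ((Finset.range N).filter fun k => z i j < z k j).card < r + 2 * r * p := by
  simpa [iboss] using (foldl_extremes r N z (List.finRange p) ∅).2 i hi

end

/-! ### Extreme points of an iid sample -/

section

lemma continuous_cdf (ν : Measure ℝ) [IsProbabilityMeasure ν] (h : ∀ t, ν {t} = 0) :
    Continuous (cdf ν) := by
  refine continuous_iff_continuousAt.2 fun t => ?_
  have h1 := (cdf ν).measure_singleton t
  rw [measure_cdf, h t, eq_comm, ENNReal.ofReal_eq_zero, sub_nonpos] at h1
  rw [(cdf ν).mono.continuousAt_iff_leftLim_eq_rightLim, (cdf ν).rightLim_eq]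
  exact le_antisymm ((cdf ν).mono.leftLim_le le_rfl) h1

/-- Without atoms the distribution function is continuous, so the intermediate value theorem
provides exact quantiles. -/
lemma exists_measureReal_Ioi_eq (ν : Measure ℝ) [IsProbabilityMeasure ν] (h : ∀ t, ν {t} = 0)
    {q : ℝ} (hq0 : 0 < q) (hq1 : q < 1) : ∃ t, ν.real (Set.Ioi t) = q := by
  obtain ⟨a, ha⟩ := ((tendsto_cdf_atBot ν).eventually_lt_const (by linarith : 0 < 1 - q)).exists
  obtain ⟨b, hb⟩ := ((tendsto_cdf_atTop ν).eventually_const_lt (by linarith : 1 - q < 1)).exists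
  obtain ⟨t, ht⟩ := mem_range_of_exists_le_of_exists_ge (continuous_cdf ν h) ⟨a, ha.le⟩ ⟨b, hb.le⟩
  refine ⟨t, ?_⟩
  rw [← Set.compl_Iic, probReal_compl_eq_one_sub measurableSet_Iic, ← cdf_eq_real, ht]
  ring

variable {Ω E : Type*} [MeasurableSpace Ω] [MeasurableSpace E] {P : Measure Ω}
  {ν : Measure E} {u : ℕ → Ω → E}

lemma measureReal_preimage_of_hasLaw {X : Ω → E} (hX : HasLaw X ν P) {A : Set E}
    (hA : MeasurableSet A) : P.real (X ⁻¹' A) = ν.real A := by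
  rw [← hX.map_eq, measureReal_def, measureReal_def, Measure.map_apply_of_aemeasurable
    hX.aemeasurable hA]

open Classical in
/-- Chebyshev's inequality for the number of visits to a set. -/
lemma measureReal_card_lt_le [IsProbabilityMeasure P] (hu : ∀ i, HasLaw (u i) ν P)
    (hindep : iIndepFun u P) {A : Set E}
    (hA : MeasurableSet A) (N K : ℕ) (hK : K < N * ν.real A) :
    P.real {ω | ((Finset.range N).filter fun k => u k ω ∈ A).card < K} ≤
      N * ν.real A / (N * ν.real A - K) ^ 2 := by
  set f : E → ℝ := A.indicator 1 with hf
  have hfm : Measurable f := measurable_one.indicator hA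
  have hf1 (x) : ‖f x‖ ≤ 1 := by
    by_cases hx : x ∈ A <;> simp [hf, hx]
  set X : ℕ → Ω → ℝ := fun k => f ∘ u k with hX
  have hXm (k) : AEMeasurable (X k) P := hfm.comp_aemeasurable (hu k).aemeasurable
  have hXL (k) : MemLp (X k) 2 P :=
    MemLp.of_bound (hXm k).aestronglyMeasurable 1 (ae_of_all _ fun ω => hf1 _)
  have hXE (k) : ∫ ω, X k ω ∂P = ν.real A := by
    rw [(hu k).integral_comp hfm.aestronglyMeasurable, hf, integral_indicator_one hA]
  have hXV (k) : Var[X k; P] ≤ ν.real A := by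
    refine (variance_le_expectation_sq (hXm k).aestronglyMeasurable).trans_eq ?_
    rw [← hXE k]
    refine integral_congr_ae (ae_of_all _ fun ω => ?_)
    by_cases hx : u k ω ∈ A <;> simp [hX, hf, hx]
  have hind : iIndepFun X P := hindep.comp (fun _ => f) fun _ => hfm
  have hV : Var[∑ k ∈ Finset.range N, X k; P] ≤ N * ν.real A := by
    rw [IndepFun.variance_sum (fun k _ => hXL k) fun i _ j _ hij => hind.indepFun hij]
    refine (Finset.sum_le_sum fun k _ => hXV k).trans_eq ?_
    simp
  have hE : ∫ ω, (∑ k ∈ Finset.range N, X k) ω ∂P = N * ν.real A := by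
    simp only [Finset.sum_apply]
    rw [integral_finsetSum _ fun k _ => (hXL k).integrable (by norm_num)]
    simp [hXE]
  have hcount (ω) : (∑ k ∈ Finset.range N, X k) ω =
      (((Finset.range N).filter fun k => u k ω ∈ A).card : ℝ) := by
    simp [hX, hf, Set.indicator_apply]
  have hc : 0 < N * ν.real A - K := by linarith
  have hcheb := meas_ge_le_variance_div_sq (memLp_finsetSum' _ fun k (_ : k ∈ Finset.range N) =>
    hXL k) hc
  have hsub : {ω | ((Finset.range N).filter fun k => u k ω ∈ A).card < K} ⊆
      {ω | N * ν.real A - K ≤ |(∑ k ∈ Finset.range N, X k) ω -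
        ∫ ω, (∑ k ∈ Finset.range N, X k) ω ∂P|} := by
    intro ω hω
    have hω' : (((Finset.range N).filter fun k => u k ω ∈ A).card : ℝ) < K := by exact_mod_cast hω
    rw [Set.mem_ofPred_eq, hE, hcount, abs_sub_comm]
    exact (sub_le_sub_left hω'.le _).trans (le_abs_self _)
  refine (measureReal_mono hsub).trans ?_
  rw [measureReal_def]
  refine (ENNReal.toReal_mono ENNReal.ofReal_ne_top hcheb).trans ?_
  rw [ENNReal.toReal_ofReal (div_nonneg (variance_nonneg _ _) (sq_nonneg _))]
  gcongr

open Classical in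
/-- If a set is asymptotically negligible in the upper tail of a statistic `h`, then in a large
sample no point of the set is among those with the largest values of `h`. -/
theorem tendsto_measure_exists_largest_mem [IsProbabilityMeasure P]
    [IsProbabilityMeasure ν] (hu : ∀ i, HasLaw (u i) ν P) (hindep : iIndepFun u P)
    {h : E → ℝ} (hh : Measurable h) (hatom : ∀ t, ν (h ⁻¹' {t}) = 0) {B : Set E}
    (hB : MeasurableSet B)
    (htail : ∀ η > 0, ∃ δ > 0, ∀ t, ν.real (h ⁻¹' Set.Ioi t) ≤ δ →
      ν.real (h ⁻¹' Set.Ioi t ∩ B) ≤ η * ν.real (h ⁻¹' Set.Ioi t)) (K : ℕ) :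
    Tendsto (fun N => P.real {ω | ∃ i < N, u i ω ∈ B ∧
      ((Finset.range N).filter fun k => h (u i ω) < h (u k ω)).card < K}) atTop (𝓝 0) := by
  rw [Metric.tendsto_atTop]
  intro ε hε
  simp only [dist_zero_right, Real.norm_eq_abs, abs_of_nonneg measureReal_nonneg]
  -- L is the expected number of points beyond the threshold: L ≥ 2K keeps the Chebyshev bound below
  -- 4/L, and L ≥ 16/ε makes this at most ε/4.
  set L : ℝ := 2 * K + 16 / ε with hL
  have hLpos : 0 < L := by positivity
  have hLK : L / 2 ≤ L - K := by
    have : 0 < 16 / ε := by positivity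
    linarith
  have hLε : 16 ≤ L * ε := by
    rw [hL, add_mul, div_mul_cancel₀ _ hε.ne']
    have : (0 : ℝ) ≤ 2 * K * ε := by positivity
    linarith
  obtain ⟨δ, hδ, hδt⟩ := htail (ε / (4 * L)) (by positivity)
  -- N > L makes L/N an admissible tail probability, and N > L/δ puts it below δ.
  obtain ⟨N0, hN0⟩ := exists_nat_gt (max L (L / δ))
  refine ⟨N0, fun N hN => ?_⟩
  have hNr : max L (L / δ) < N := hN0.trans_le (by exact_mod_cast hN)
  have hNpos : (0 : ℝ) < N := hLpos.trans ((le_max_left _ _).trans_lt hNr)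
  have : IsProbabilityMeasure (ν.map h) := Measure.isProbabilityMeasure_map hh.aemeasurable
  obtain ⟨t, ht⟩ := exists_measureReal_Ioi_eq (ν.map h)
    (fun t => by rw [Measure.map_apply hh (measurableSet_singleton t), hatom]) (q := L / N)
    (by positivity) ((div_lt_one hNpos).2 ((le_max_left _ _).trans_lt hNr))
  rw [map_measureReal_apply hh measurableSet_Ioi] at ht
  have hA : MeasurableSet (h ⁻¹' Set.Ioi t) := hh measurableSet_Ioi
  have hNA : N * ν.real (h ⁻¹' Set.Ioi t) = L := by rw [ht]; field_simp
  have hcard := measureReal_card_lt_le hu hindep hA N K (by rw [hNA]; linarith)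
  rw [hNA] at hcard
  have hB' := hδt t (by
    rw [ht, div_le_iff₀ hNpos, mul_comm, ← div_le_iff₀ hδ]
    exact ((le_max_right _ _).trans_lt hNr).le)
  -- A bad point beyond t is a visit to the tail part of `B`. Otherwise every point beyond t is also
  -- beyond the bad point, so there are fewer than K of them.
  have hsub : {ω | ∃ i < N, u i ω ∈ B ∧
      ((Finset.range N).filter fun k => h (u i ω) < h (u k ω)).card < K} ⊆
      {ω | ((Finset.range N).filter fun k => u k ω ∈ h ⁻¹' Set.Ioi t).card < K} ∪
      ⋃ i ∈ Finset.range N, u i ⁻¹' (h ⁻¹' Set.Ioi t ∩ B) := by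
    rintro ω ⟨i, hi, hiB, hic⟩
    by_cases hit : t < h (u i ω)
    · right
      simp only [Set.mem_iUnion, Finset.mem_range]
      exact ⟨i, hi, hit, hiB⟩
    · left
      refine (Finset.card_le_card fun k hk => ?_).trans_lt hic
      rw [Finset.mem_filter] at hk ⊢
      exact ⟨hk.1, (not_lt.1 hit).trans_lt hk.2⟩
  calc _ ≤ _ := measureReal_mono hsub
    _ ≤ _ := measureReal_union_le _ _
    _ ≤ L / (L - K) ^ 2 + ∑ i ∈ Finset.range N, P.real (u i ⁻¹' (h ⁻¹' Set.Ioi t ∩ B)) :=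
        add_le_add hcard (measureReal_biUnion_finset_le _ _)
    _ = L / (L - K) ^ 2 + N * ν.real (h ⁻¹' Set.Ioi t ∩ B) := by
        simp only [measureReal_preimage_of_hasLaw (hu _) (hA.inter hB)]
        simp
    _ ≤ L / (L / 2) ^ 2 + N * (ε / (4 * L) * ν.real (h ⁻¹' Set.Ioi t)) := by gcongr
    _ = 4 / L + ε / (4 * L) * (N * ν.real (h ⁻¹' Set.Ioi t)) := by field_simp; ring
    _ = 4 / L + ε / 4 := by rw [hNA]; field_simp
    _ ≤ ε / 4 + ε / 4 := by
        refine add_le_add_left ?_ _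
        rw [div_le_iff₀ hLpos]; linarith
    _ < ε := by linarith

end

/-! ### Gaussian regression on one linear statistic -/

section

section Regression

variable {E : Type*} [NormedAddCommGroup E] [InnerProductSpace ℝ E]

/-- The residual of `u` in the regression on `⟪a, u⟫`, with direction `c`. -/
def residual (a c u : E) : E := u - inner ℝ a u • c

lemma inner_smul_add_residual (a c u : E) : inner ℝ a u • c + residual a c u = u := by
  simp [residual]

variable [SecondCountableTopology E] [MeasurableSpace E] [BorelSpace E]

lemma measurable_residual (a c : E) : Measurable (residual a c) := by
  unfold residual; fun_prop

variable [CompleteSpace E]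

/-- The two variables are jointly Gaussian, and `hc`, which says that c is the regression direction
Σa / (aᵀΣa), makes them uncorrelated. -/
lemma indepFun_inner_residual (ν : Measure E) [IsGaussian ν] {a c : E}
    (hc : ∀ y, covarianceBilin ν a y = covarianceBilin ν a a * inner ℝ y c) :
    IndepFun (fun u => inner ℝ a u) (residual a c) ν := by
  have hG : HasGaussianLaw (fun u : E => (inner ℝ a u, residual a c u)) ν := by
    have h := (IsGaussian.hasGaussianLaw_id (μ := ν)).map
      ((innerSL ℝ a).prod (ContinuousLinearMap.id ℝ E - (innerSL ℝ a).smulRight c))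
    exact h
  refine hG.indepFun_of_covariance_inner fun x y => ?_
  have e1 : (fun u : E => inner ℝ x (inner ℝ a u)) = fun u => inner ℝ (x • a) u := by
    ext u
    simp [inner_smul_left, mul_comm]
  have e2 : (fun u : E => inner ℝ y (residual a c u)) =
      fun u => inner ℝ (y - inner ℝ y c • a) u := by
    ext u
    simp only [residual, inner_sub_right, inner_sub_left, inner_smul_left, inner_smul_right]
    simp [mul_comm]
  rw [e1, e2, ← covarianceBilin_apply_eq_cov IsGaussian.memLp_two_id]
  simp only [map_smul, map_sub, smul_apply, smul_eq_mul]
  rw [hc y]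
  ring

lemma exists_map_inner_eq_gaussianReal {ν : Measure E} [IsGaussian ν] (a : E)
    (h : covarianceBilin ν a a ≠ 0) : ∃ v : NNReal, v ≠ 0 ∧
    ν.map (fun u => inner ℝ a u) = gaussianReal (∫ u, inner ℝ a u ∂ν) v := by
  have hG : HasGaussianLaw (fun u : E => inner ℝ a u) ν :=
    (IsGaussian.hasGaussianLaw_id (μ := ν)).map (innerSL ℝ a)
  refine ⟨_, ?_, hG.map_eq_gaussianReal⟩
  rw [covarianceBilin_apply_eq_cov IsGaussian.memLp_two_id, covariance_self (by fun_prop)] at h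
  simpa using lt_of_le_of_ne (variance_nonneg _ _) h.symm

/-- Fubini for the independent pair (s, residual), in both orders: conditioning on the statistic
serves the tail estimate, conditioning on the residual serves null sets. -/
lemma measure_eq_lintegral_residual (ν : Measure E) [IsGaussian ν] {a c : E}
    (hc : ∀ y, covarianceBilin ν a y = covarianceBilin ν a a * inner ℝ y c) {B : Set E}
    (hB : MeasurableSet B) :
    ν B = ∫⁻ s, ν {u | s • c + residual a c u ∈ B} ∂ν.map (fun u => inner ℝ a u) ∧
    ν B = ∫⁻ r, ν.map (fun u => inner ℝ a u) {s | s • c + r ∈ B} ∂ν.map (residual a c) := by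
  have hR := measurable_residual a c
  have hX : Measurable fun u : E => inner ℝ a u := by fun_prop
  have hT : Measurable fun q : ℝ × E => q.1 • c + q.2 := by fun_prop
  have hprod := (indepFun_iff_map_prod_eq_prod_map_map hX.aemeasurable hR.aemeasurable).1
    (indepFun_inner_residual ν hc)
  have : IsProbabilityMeasure (ν.map fun u => inner ℝ a u) :=
    Measure.isProbabilityMeasure_map hX.aemeasurable
  have : IsProbabilityMeasure (ν.map (residual a c)) :=
    Measure.isProbabilityMeasure_map hR.aemeasurable
  have e : ν B = ((ν.map fun u => inner ℝ a u).prod (ν.map (residual a c)))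
      ((fun q : ℝ × E => q.1 • c + q.2) ⁻¹' B) := by
    rw [← hprod, Measure.map_apply (hX.prodMk hR) (hT hB)]
    congr 1
    ext u
    simp [inner_smul_add_residual]
  constructor
  · rw [e, Measure.prod_apply (hT hB)]
    refine lintegral_congr fun s => ?_
    rw [Measure.map_apply hR]
    · rfl
    · exact measurable_prodMk_left (hT hB)
  · rw [e, Measure.prod_apply_symm (hT hB)]
    rfl

lemma measure_eq_zero_of_subsingleton (ν : Measure E) [IsGaussian ν] {a c : E}
    (hc : ∀ y, covarianceBilin ν a y = covarianceBilin ν a a * inner ℝ y c)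
    (ha : covarianceBilin ν a a ≠ 0) {B : Set E} (hB : MeasurableSet B)
    (hsub : ∀ r, {s : ℝ | s • c + r ∈ B}.Subsingleton) : ν B = 0 := by
  obtain ⟨v, hv, hmap⟩ := exists_map_inner_eq_gaussianReal a ha
  have := nullSingletonClass_gaussianReal (μ := ∫ u, inner ℝ a u ∂ν) hv
  rw [(measure_eq_lintegral_residual ν hc hB).2, hmap]
  simp [(hsub _).measure_zero]

/-- The conditional probability of `B` given that the statistic equals s tends to 0 as s → ∞, by
dominated convergence, so it is at most η beyond some T. -/
lemma exists_tail_le (ν : Measure E) [IsGaussian ν] {a c : E}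
    (hc : ∀ y, covarianceBilin ν a y = covarianceBilin ν a a * inner ℝ y c)
    (ha : covarianceBilin ν a a ≠ 0) {B : Set E} (hB : MeasurableSet B)
    (htail : ∀ᵐ u ∂ν, ∀ᶠ s : ℝ in atTop, s • c + residual a c u ∉ B) {η : ℝ} (hη : 0 < η) :
    ∃ δ > 0, ∀ t, ν.real ((fun u => inner ℝ a u) ⁻¹' Set.Ioi t) ≤ δ →
      ν.real ((fun u => inner ℝ a u) ⁻¹' Set.Ioi t ∩ B) ≤
        η * ν.real ((fun u => inner ℝ a u) ⁻¹' Set.Ioi t) := by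
  have hR := measurable_residual a c
  have hX : Measurable fun u : E => inner ℝ a u := by fun_prop
  obtain ⟨v, hv, hmap⟩ := exists_map_inner_eq_gaussianReal a ha
  have hψ : Tendsto (fun s : ℝ => ν {u | s • c + residual a c u ∈ B}) atTop (𝓝 0) := by
    have hm (s : ℝ) : MeasurableSet {u | s • c + residual a c u ∈ B} :=
      (by fun_prop : Measurable fun u => s • c + residual a c u) hB
    have h := tendsto_lintegral_filter_of_dominated_convergence (μ := ν) (l := (atTop : Filter ℝ))
      (F := fun s => {u | s • c + residual a c u ∈ B}.indicator 1) (f := fun _ => 0) (fun _ => 1)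
      (.of_forall fun s => measurable_one.indicator (hm s))
      (.of_forall fun s => ae_of_all _ fun u => Set.indicator_le_self' (by simp) u) (by simp)
      (by
        filter_upwards [htail] with u hu
        refine tendsto_const_nhds.congr' ?_
        filter_upwards [hu] with s hs
        simp [hs])
    simpa [lintegral_indicator_one (hm _)] using h
  obtain ⟨T, hT⟩ := eventually_atTop.1
    (hψ.eventually_le_const (u := ENNReal.ofReal η) (by simpa using hη))
  have hpos : 0 < ν.real ((fun u => inner ℝ a u) ⁻¹' Set.Ioi T) := by
    rw [measureReal_def, ← Measure.map_apply hX measurableSet_Ioi, hmap]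
    refine ENNReal.toReal_pos (fun h0 => ?_) (measure_ne_top _ _)
    have := gaussianReal_absolutelyContinuous' (∫ u, inner ℝ a u ∂ν) hv h0
    simp at this
  -- With δ half of the mass beyond T, a tail of mass at most δ must start at or after T.
  refine ⟨_, half_pos hpos, fun t ht => ?_⟩
  have htT : T ≤ t := by
    by_contra! hlt
    have := measureReal_mono (μ := ν) (Set.preimage_mono (f := fun u => inner ℝ a u)
      (Set.Ioi_subset_Ioi hlt.le))
    linarith
  have hA : MeasurableSet ((fun u => inner ℝ a u) ⁻¹' Set.Ioi t) := hX measurableSet_Ioi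
  rw [measureReal_def, measureReal_def, ← ENNReal.toReal_ofReal hη.le, ← ENNReal.toReal_mul]
  refine ENNReal.toReal_mono (ENNReal.mul_ne_top ENNReal.ofReal_ne_top (measure_ne_top _ _)) ?_
  -- Thus s is the value of the statistic at s c + residual, and the slice is empty for s ≤ t.
  have hac : inner ℝ a c = (1 : ℝ) := by
    have := hc a
    exact mul_left_cancel₀ ha (by linarith)
  have hin (s : ℝ) (u : E) : inner ℝ a (s • c + residual a c u) = s := by
    simp [residual, inner_add_right, inner_sub_right, inner_smul_right, hac]
  rw [(measure_eq_lintegral_residual ν hc (hA.inter hB)).1, ← Measure.map_apply hX measurableSet_Ioi]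
  calc _ ≤ ∫⁻ s, (Set.Ioi t).indicator (fun _ => ENNReal.ofReal η) s
        ∂ν.map (fun u => inner ℝ a u) := by
        refine lintegral_mono fun s => ?_
        by_cases hs : t < s
        · rw [Set.indicator_of_mem (by exact hs)]
          refine (measure_mono fun u hu => ?_).trans (hT s (htT.trans hs.le))
          exact hu.2
        · rw [Set.indicator_of_notMem (by exact hs)]
          refine le_of_eq (measure_mono_null (t := ∅) (fun u hu => ?_) measure_empty)
          have := hu.1
          rw [Set.mem_preimage, hin] at this
          exact hs this
    _ = _ := by rw [lintegral_indicator_const measurableSet_Ioi]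

lemma measure_preimage_inner_singleton (ν : Measure E) [IsGaussian ν] {a : E}
    (ha : covarianceBilin ν a a ≠ 0) (t : ℝ) : ν ((fun u => inner ℝ a u) ⁻¹' {t}) = 0 := by
  obtain ⟨v, hv, hmap⟩ := exists_map_inner_eq_gaussianReal a ha
  have := nullSingletonClass_gaussianReal (μ := ∫ u, inner ℝ a u ∂ν) hv
  rw [← Measure.map_apply (by fun_prop) (measurableSet_singleton t), hmap, measure_singleton]

end Regression

end

/-! ### Vanishing of the bound along the regression rays -/

section

variable {m p : ℕ}

/-- With D ~ c w and x = O(w), the product is at most O(w²) exp(-κ c² w²/2). -/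
lemma tendsto_mul_exp_neg_sq {α : Type*} {l : Filter α} {κ c n : ℝ} (hκ : 0 < κ) (hc : c ≠ 0)
    {w D x : α → ℝ} (hw : Tendsto w l atTop) (hD : Tendsto (fun i => D i / w i) l (𝓝 c))
    (hx : Tendsto (fun i => x i / w i) l (𝓝 n)) :
    Tendsto (fun i => (1 + x i ^ 2) * Real.exp (-κ * D i ^ 2)) l (𝓝 0) := by
  have hc2 : 0 < c ^ 2 := by positivity
  have hb : 0 < κ * (c ^ 2 / 2) := by positivity
  have h1 : Tendsto (fun i => (w i ^ 2) ^ 1 * Real.exp (-(κ * (c ^ 2 / 2)) * w i ^ 2)) l (𝓝 0) := by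
    have h := Real.tendsto_pow_mul_exp_neg_atTop_nhds_zero 1
    have h' := (h.comp (((tendsto_pow_atTop two_ne_zero).comp hw).const_mul_atTop hb)).const_mul
      (κ * (c ^ 2 / 2))⁻¹
    rw [mul_zero] at h'
    refine h'.congr fun i => ?_
    simp only [Function.comp_apply, pow_one]
    field_simp
  have h2 : Tendsto (fun i => (1 / w i) ^ 2 + (x i / w i) ^ 2) l (𝓝 (0 ^ 2 + n ^ 2)) :=
    ((hw.const_div_atTop 1).pow 2).add (hx.pow 2)
  have h3 := h2.mul h1
  rw [mul_zero] at h3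
  refine squeeze_zero' (.of_forall fun i => by positivity) ?_ h3
  filter_upwards [hw.eventually_gt_atTop 0,
    (hD.pow 2).eventually_const_lt (by linarith : c ^ 2 / 2 < c ^ 2)] with i hi hDi
  have e : D i ^ 2 = (D i / w i) ^ 2 * w i ^ 2 := by field_simp
  have e' : 1 + x i ^ 2 = ((1 / w i) ^ 2 + (x i / w i) ^ 2) * w i ^ 2 := by field_simp
  rw [e', mul_assoc, pow_one]
  refine mul_le_mul_of_nonneg_left (mul_le_mul_of_nonneg_left (Real.exp_le_exp.2 ?_)
    (by positivity)) (by positivity)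
  rw [neg_mul, neg_mul, neg_le_neg_iff, e, mul_assoc]
  gcongr

lemma linPred_sub (θ : Idx m p → ℝ) (z : EuclideanSpace ℝ (Fin p)) (g h : Fin (m + 1)) :
    linPred θ z g - linPred θ z h =
      (coef θ g 0 - coef θ h 0) + ∑ l, (coef θ g l.succ - coef θ h l.succ) * z l := by
  simp only [linPred, Fin.sum_univ_succ, design, Fin.cons_zero, Fin.cons_succ, one_mul]
  simp only [sub_mul, Finset.sum_sub_distrib, mul_comm (z.ofLp _)]
  ring

lemma tendsto_sepBound {α : Type*} {f : Filter α} {θ : Idx m p → ℝ} {κ : ℝ} (hκ : 0 < κ)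
    {w : α → ℝ} {z : α → EuclideanSpace ℝ (Fin p)} {ζ : Fin p → ℝ} (hw : Tendsto w f atTop)
    (hz : ∀ l, Tendsto (fun i => z i l / w i) f (𝓝 (ζ l)))
    (hζ : ∀ g h : Fin (m + 1), g ≠ h →
      ∑ l, (coef θ g l.succ - coef θ h l.succ) * ζ l ≠ 0) :
    Tendsto (fun i => sepBound θ κ (z i)) f (𝓝 0) := by
  rw [show (0 : ℝ) = ∑ q ∈ (Finset.univ : Finset (Fin (m + 1))).offDiag, 0 by simp]
  refine tendsto_finsetSum _ fun q hq => ?_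
  have hne : q.1 ≠ q.2 := by simpa using hq
  refine tendsto_mul_exp_neg_sq (n := √(∑ l, ζ l ^ 2)) hκ (hζ _ _ hne) hw ?_ ?_
  · have h := (hw.const_div_atTop (coef θ q.1 0 - coef θ q.2 0)).add
      (tendsto_finsetSum Finset.univ fun l _ =>
        (hz l).const_mul (coef θ q.1 l.succ - coef θ q.2 l.succ))
    rw [zero_add] at h
    refine h.congr fun i => ?_
    rw [linPred_sub, add_div, Finset.sum_div]
    simp only [mul_div_assoc]
  · have h := (tendsto_finsetSum Finset.univ fun l _ => (hz l).pow 2).sqrt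
    refine h.congr' ?_
    filter_upwards [hw.eventually_gt_atTop 0] with i hi
    rw [EuclideanSpace.norm_eq]
    simp only [div_pow, Real.norm_eq_abs, sq_abs]
    rw [← Finset.sum_div, Real.sqrt_div (Finset.sum_nonneg fun l _ => sq_nonneg _),
      Real.sqrt_sq hi.le]

lemma covarianceBilin_multivariateGaussian_eq_inner (μ : EuclideanSpace ℝ (Fin p))
    {S : Matrix (Fin p) (Fin p) ℝ} (hS : S.PosDef) {a : EuclideanSpace ℝ (Fin p)} (ha : a ≠ 0) :
    covarianceBilin (multivariateGaussian μ S) a a ≠ 0 ∧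
    ∀ y, covarianceBilin (multivariateGaussian μ S) a y =
      covarianceBilin (multivariateGaussian μ S) a a * inner ℝ y
        ((covarianceBilin (multivariateGaussian μ S) a a)⁻¹ •
          (WithLp.toLp 2 (S.mulVec a) : EuclideanSpace ℝ (Fin p))) := by
  have h0 : covarianceBilin (multivariateGaussian μ S) a a ≠ 0 := by
    rw [covarianceBilin_multivariateGaussian hS.posSemidef]
    have := hS.dotProduct_mulVec_pos (x := a.ofLp) (by simpa using ha)
    simpa using this.ne'
  refine ⟨h0, fun y => ?_⟩
  rw [inner_smul_right, mul_inv_cancel_left₀ h0, covarianceBilin_comm,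
    covarianceBilin_multivariateGaussian hS.posSemidef]
  simp [EuclideanSpace.inner_eq_star_dotProduct, dotProduct_comm]

variable {μz : EuclideanSpace ℝ (Fin p)} {σz : Fin p → ℝ} {ρ : Matrix (Fin p) (Fin p) ℝ}

/-- The regression coefficients of the covariates on the signed covariate `τ u_j`, `τ = ± 1`. -/
def slope (σz : Fin p → ℝ) (ρ : Matrix (Fin p) (Fin p) ℝ) (j : Fin p) (τ : ℝ) :
    EuclideanSpace ℝ (Fin p) :=
  WithLp.toLp 2 fun l => τ * (ρ l j * σz l) / σz j

instance : IsGaussian (normalLaw μz σz ρ) := by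
  unfold normalLaw; infer_instance

lemma covarianceBilin_normalLaw_single (hσ : ∀ j, 0 < σz j) (hρ : ∀ j, ρ j j = 1)
    (hcov : (Matrix.diagonal σz * ρ * Matrix.diagonal σz).PosDef) (j : Fin p) {τ : ℝ}
    (hτ : τ = 1 ∨ τ = -1) :
    covarianceBilin (normalLaw μz σz ρ) (EuclideanSpace.single j τ)
      (EuclideanSpace.single j τ) ≠ 0 ∧
    ∀ y, covarianceBilin (normalLaw μz σz ρ) (EuclideanSpace.single j τ) y =
      covarianceBilin (normalLaw μz σz ρ) (EuclideanSpace.single j τ)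
        (EuclideanSpace.single j τ) * inner ℝ y (slope σz ρ j τ) := by
  have hτ0 : τ ≠ 0 := by rcases hτ with rfl | rfl <;> norm_num
  have hττ : τ * τ = 1 := by rcases hτ with rfl | rfl <;> norm_num
  have hj := (hσ j).ne'
  have h := covarianceBilin_multivariateGaussian_eq_inner μz hcov
    (a := EuclideanSpace.single j τ) (by simpa using hτ0)
  refine ⟨h.1, ?_⟩
  have hv : covarianceBilin (normalLaw μz σz ρ) (EuclideanSpace.single j τ)
      (EuclideanSpace.single j τ) = σz j ^ 2 := by
    rw [normalLaw, covarianceBilin_multivariateGaussian hcov.posSemidef]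
    simp [Matrix.mulVec_single, hρ, Matrix.mul_diagonal, Matrix.diagonal_mul]
    linear_combination σz j ^ 2 * hττ
  have e : slope σz ρ j τ = (covarianceBilin (normalLaw μz σz ρ) (EuclideanSpace.single j τ)
      (EuclideanSpace.single j τ))⁻¹ • (WithLp.toLp 2 ((Matrix.diagonal σz * ρ *
        Matrix.diagonal σz).mulVec (EuclideanSpace.single j τ).ofLp) :
        EuclideanSpace ℝ (Fin p)) := by
    ext l
    simp [slope, hv, Matrix.mulVec_single, Matrix.mul_diagonal, Matrix.diagonal_mul]
    field_simp
  rw [e]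
  exact h.2

/-- For a = Σ⁻¹ e_k the regression direction is a multiple of e_k. Each line in this direction
changes only the coordinate k, so by injectivity of exp it meets the zero set at most once. -/
lemma ae_sum_mul_exp_ne_zero
    (hcov : (Matrix.diagonal σz * ρ * Matrix.diagonal σz).PosDef) {A : Finset (Fin p)}
    (hA : A.Nonempty) {d : Fin p → ℝ} (hd : ∀ l, d l ≠ 0) :
    ∀ᵐ u ∂normalLaw μz σz ρ, ∑ l ∈ A, d l * Real.exp (u l) ≠ 0 := by
  obtain ⟨k, hk⟩ := hA
  set S := Matrix.diagonal σz * ρ * Matrix.diagonal σz with hS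
  set a : EuclideanSpace ℝ (Fin p) := WithLp.toLp 2 (S⁻¹.mulVec (Pi.single k 1)) with ha
  have hSa : S.mulVec a = Pi.single k 1 := by
    rw [ha, Matrix.mulVec_mulVec, Matrix.mul_nonsing_inv _
      ((Matrix.isUnit_iff_isUnit_det _).1 hcov.isUnit), Matrix.one_mulVec]
  have ha0 : a ≠ 0 := by
    intro h
    have := congrFun hSa k
    simp [h] at this
  obtain ⟨h1, h2⟩ := covarianceBilin_multivariateGaussian_eq_inner μz hcov ha0
  rw [hSa] at h2
  have h0 := measure_eq_zero_of_subsingleton (normalLaw μz σz ρ) h2 h1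
    (B := {u | ∑ l ∈ A, d l * Real.exp (u l) = 0})
    (measurableSet_eq_fun (by fun_prop) measurable_const) ?_
  · rw [ae_iff]
    simpa using h0
  · intro r s hs t ht
    set v := (covarianceBilin (multivariateGaussian μz S)) a a with hv
    simp only [Set.mem_ofPred_eq, ← Finset.add_sum_erase A _ hk] at hs ht
    have e (s : ℝ) : ∑ l ∈ A.erase k, d l * Real.exp ((s • v⁻¹ • (WithLp.toLp 2
        (Pi.single k 1) : EuclideanSpace ℝ (Fin p)) + r) l) =
        ∑ l ∈ A.erase k, d l * Real.exp (r l) := by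
      refine Finset.sum_congr rfl fun l hl => ?_
      simp [Finset.ne_of_mem_erase hl]
    rw [e] at hs ht
    have h3 := mul_left_cancel₀ (hd k) (add_right_cancel (hs.trans ht.symm))
    have h4 := Real.exp_injective h3
    simpa [h1] using h4

theorem tendsto_sepBound_normal {θ : Idx m p → ℝ} {κ : ℝ} (hκ : 0 < κ) (hσ : ∀ j, 0 < σz j)
    (h : NormalCond θ σz ρ) (j : Fin p) {τ : ℝ} (hτ : τ = 1 ∨ τ = -1)
    (r : EuclideanSpace ℝ (Fin p)) :
    Tendsto (fun s : ℝ => sepBound θ κ (s • slope σz ρ j τ + r)) atTop (𝓝 0) := by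
  refine tendsto_sepBound hκ tendsto_id (ζ := slope σz ρ j τ) (fun l => ?_) fun g g' hg => ?_
  · have h1 := (tendsto_id.const_div_atTop (r l)).const_add (slope σz ρ j τ l)
    rw [add_zero] at h1
    refine h1.congr' ?_
    filter_upwards [eventually_gt_atTop 0] with s hs
    simp [add_div, hs.ne']
  · have hτ0 : τ ≠ 0 := by rcases hτ with rfl | rfl <;> norm_num
    have e : ∑ l, (coef θ g l.succ - coef θ g' l.succ) * slope σz ρ j τ l =
        τ / σz j * ∑ l, ρ l j * σz l * (coef θ g l.succ - coef θ g' l.succ) := by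
      rw [Finset.mul_sum]
      exact Finset.sum_congr rfl fun l _ => by simp only [slope]; ring
    rw [e]
    exact mul_ne_zero (div_ne_zero hτ0 (hσ j).ne') (h g g' hg j)

/-- The coordinatewise exponential. -/
def expVec (u : EuclideanSpace ℝ (Fin p)) : EuclideanSpace ℝ (Fin p) :=
  WithLp.toLp 2 fun j => Real.exp (u j)

/-- Guarantees that some lognormal covariate diverges along the ray. Upwards this is the covariate j
itself; downwards it is one with the negative minimal correlation. -/
lemma exists_slope_pos {θ : Idx m p → ℝ} (hm : ∃ g g' : Fin (m + 1), g ≠ g')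
    (hσ : ∀ j, 0 < σz j) (hρ : ∀ j, ρ j j = 1) (h : LognormalCond θ ρ) (j : Fin p) {τ : ℝ}
    (hτ : τ = 1 ∨ τ = -1) : ∃ l, 0 < slope σz ρ j τ l := by
  rcases hτ with rfl | rfl
  · exact ⟨j, by simp [slope, hρ, (hσ j).ne']⟩
  · obtain ⟨g, g', hg⟩ := hm
    have : Nonempty (Fin p) := ⟨j⟩
    obtain ⟨l, hl⟩ := exists_eq_ciInf_of_finite (f := fun l => ρ l j)
    have hneg := (h g g' hg j).2.2
    rw [rhoMin, ← hl] at hneg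
    refine ⟨l, div_pos ?_ (hσ j)⟩
    have := mul_neg_of_neg_of_pos hneg (hσ l)
    linarith

theorem tendsto_sepBound_lognormal {θ : Idx m p → ℝ} {κ : ℝ} (hκ : 0 < κ) (hσ : ∀ j, 0 < σz j)
    (hρ : ∀ j, ρ j j = 1) (hcov : (Matrix.diagonal σz * ρ * Matrix.diagonal σz).PosDef)
    (h : LognormalCond θ ρ) (j : Fin p) {τ : ℝ} (hτ : τ = 1 ∨ τ = -1) :
    ∀ᵐ u ∂normalLaw μz σz ρ, Tendsto (fun s : ℝ => sepBound θ κ (expVec (s • slope σz ρ j τ +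
      residual (EuclideanSpace.single j τ) (slope σz ρ j τ) u))) atTop (𝓝 0) := by
  classical
  -- With a single cluster the bound is an empty sum.
  by_cases hm : ∃ g g' : Fin (m + 1), g ≠ g'
  swap
  · push Not at hm
    refine ae_of_all _ fun u => ?_
    have : (Finset.univ : Finset (Fin (m + 1))).offDiag = ∅ := by
      ext q; simp [hm q.1 q.2]
    simp [sepBound, this]
  have : Nonempty (Fin p) := ⟨j⟩
  set b := slope σz ρ j τ with hb
  obtain ⟨l₀, hl₀⟩ := Finite.exists_max b.ofLp
  have hpos : 0 < b l₀ := by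
    obtain ⟨l, hl⟩ := exists_slope_pos hm hσ hρ h j hτ
    exact hl.trans_le (hl₀ l)
  set A := Finset.univ.filter fun l => b l = b l₀ with hA
  have hAne : A.Nonempty := ⟨l₀, by simp [hA]⟩
  have hae : ∀ᵐ u ∂normalLaw μz σz ρ, ∀ g g' : Fin (m + 1), g ≠ g' →
      ∑ l ∈ A, (coef θ g l.succ - coef θ g' l.succ) * Real.exp (u l) ≠ 0 := by
    simp only [ae_all_iff]
    exact fun g g' hg => ae_sum_mul_exp_ne_zero hcov hAne fun l => (h g g' hg l).1
  filter_upwards [hae] with u hu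
  set x := inner ℝ (EuclideanSpace.single j τ) u with hx
  set r := residual (EuclideanSpace.single j τ) b u with hr
  have hrl (l) : r l = u l - x * b l := by simp [hr, residual, hx]
  -- Scaling by the fastest growing exponential leaves only the coordinates in `A` in the limit.
  refine tendsto_sepBound hκ (w := fun s => Real.exp (b l₀ * s))
    (ζ := fun l => if l ∈ A then Real.exp (r l) else 0)
    (Real.tendsto_exp_atTop.comp (tendsto_id.const_mul_atTop hpos)) (fun l => ?_)
    fun g g' hg => ?_
  · have e (s : ℝ) : expVec (s • b + r) l / Real.exp (b l₀ * s) =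
        Real.exp (r l) * Real.exp ((b l - b l₀) * s) := by
      rw [← Real.exp_add, expVec, ← Real.exp_sub]
      congr 1
      simp
      ring
    simp only [e]
    split_ifs with hl
    · have hl' : b l = b l₀ := by simpa [hA] using hl
      simp [hl']
    · have hl' : b l < b l₀ := lt_of_le_of_ne (hl₀ l) (by simpa [hA] using hl)
      rw [← mul_zero (Real.exp (r l))]
      exact (Real.tendsto_exp_atBot.comp
        (tendsto_id.const_mul_atTop_of_neg (sub_neg.2 hl'))).const_mul _
  -- On `A` the slope is constant, so passing from the residual to u only costs a common positive
  -- factor.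
  · have e : ∑ l, (coef θ g l.succ - coef θ g' l.succ) * (if l ∈ A then Real.exp (r l) else 0) =
        Real.exp (-(x * b l₀)) *
          ∑ l ∈ A, (coef θ g l.succ - coef θ g' l.succ) * Real.exp (u l) := by
      simp only [mul_ite, mul_zero, Finset.sum_ite_mem, Finset.univ_inter, Finset.mul_sum]
      refine Finset.sum_congr rfl fun l hl => ?_
      have hl' : b l = b l₀ := by simpa [hA] using hl
      rw [hrl, hl', sub_eq_neg_add (u l), Real.exp_add]
      ring
    rw [e]
    exact mul_ne_zero (Real.exp_ne_zero _) (hu g g' hg)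

end

/-! ### Convergence in probability over the subdata -/

section

variable {m p : ℕ} {μz : EuclideanSpace ℝ (Fin p)} {σz : Fin p → ℝ}
  {ρ : Matrix (Fin p) (Fin p) ℝ} {Ω : Type*} [MeasurableSpace Ω] {P : Measure Ω}
  {u z : ℕ → Ω → EuclideanSpace ℝ (Fin p)}

/-- As Φ preserves the order in each coordinate, the ranks of z are those of the Gaussian sample u.
The identity and the exponential are the two cases of interest. -/
theorem tendsto_measure_exists_iboss_le_sepBound [IsProbabilityMeasure P] (r : ℕ)
    (θ : Idx m p → ℝ) (κ : ℝ)
    (hσ : ∀ j, 0 < σz j) (hρ : ∀ j, ρ j j = 1)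
    (hcov : (Matrix.diagonal σz * ρ * Matrix.diagonal σz).PosDef)
    (hu : ∀ i, HasLaw (u i) (normalLaw μz σz ρ) P) (hindep : iIndepFun u P)
    {Φ : EuclideanSpace ℝ (Fin p) → EuclideanSpace ℝ (Fin p)} (hΦm : Measurable Φ)
    (hΦ : ∀ x y j, Φ x j < Φ y j ↔ x j < y j)
    (htend : ∀ j τ, (τ = 1 ∨ τ = -1) → ∀ᵐ x ∂normalLaw μz σz ρ,
      Tendsto (fun s : ℝ => sepBound θ κ (Φ (s • slope σz ρ j τ +
        residual (EuclideanSpace.single j τ) (slope σz ρ j τ) x))) atTop (𝓝 0))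
    (hz : ∀ᵐ ω ∂P, ∀ i, z i ω = Φ (u i ω)) {ε : ℝ} (hε : 0 < ε) :
    Tendsto (fun N => P.real {ω | ∃ i ∈ iboss r N (fun i => z i ω), ε ≤ sepBound θ κ (z i ω)})
      atTop (𝓝 0) := by
  classical
  set B : Set (EuclideanSpace ℝ (Fin p)) := {x | ε ≤ sepBound θ κ (Φ x)} with hB
  have hBm : MeasurableSet B :=
    measurableSet_le measurable_const ((measurable_sepBound θ κ).comp hΦm)
  set K := r + 2 * r * p with hK
  set Q : Fin p → ℝ → ℕ → Set Ω := fun j τ N => {ω | ∃ i < N, u i ω ∈ B ∧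
      ((Finset.range N).filter fun k => inner ℝ (EuclideanSpace.single j τ) (u i ω) <
        inner ℝ (EuclideanSpace.single j τ) (u k ω)).card < K} with hQ
  have hlim (j τ) (hτ : τ = 1 ∨ τ = -1) : Tendsto (fun N => P.real (Q j τ N)) atTop (𝓝 0) := by
    obtain ⟨h1, h2⟩ := covarianceBilin_normalLaw_single (μz := μz) hσ hρ hcov j hτ
    refine tendsto_measure_exists_largest_mem hu hindep
      (h := fun x => inner ℝ (EuclideanSpace.single j τ) x) (by fun_prop)
      (measure_preimage_inner_singleton _ h1) hBm (fun η hη => ?_) K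
    refine exists_tail_le _ h2 h1 hBm ?_ hη
    filter_upwards [htend j τ hτ] with x hx
    filter_upwards [hx.eventually_lt_const hε] with s hs
    simpa [hB] using hs
  have hsum : Tendsto (fun N => ∑ j, (P.real (Q j 1 N) + P.real (Q j (-1) N))) atTop (𝓝 0) := by
    have := tendsto_finsetSum Finset.univ fun (j : Fin p) _ =>
      (hlim j 1 (.inl rfl)).add (hlim j (-1) (.inr rfl))
    simpa using this
  refine squeeze_zero (fun N => measureReal_nonneg) (fun N => ?_) hsum
  have hsub : ∀ᵐ ω ∂P, ω ∈ {ω | ∃ i ∈ iboss r N (fun i => z i ω), ε ≤ sepBound θ κ (z i ω)} →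
      ω ∈ ⋃ j ∈ (Finset.univ : Finset (Fin p)), (Q j 1 N ∪ Q j (-1) N) := by
    filter_upwards [hz] with ω hω
    rintro ⟨i, hi, hle⟩
    obtain ⟨hiN, j, hj⟩ := mem_iboss hi
    simp only [hω, hΦ] at hj hle
    simp only [Finset.mem_univ, Set.iUnion_true, Set.mem_iUnion]
    refine ⟨j, ?_⟩
    -- Few smaller values of u_j means few larger values of -u_j, the case τ = -1.
    rcases hj with hj | hj
    · right
      exact ⟨i, hiN, hle, by simpa [EuclideanSpace.inner_single_left] using hj⟩
    · left
      exact ⟨i, hiN, hle, by simpa [EuclideanSpace.inner_single_left] using hj⟩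
  calc _ ≤ P.real (⋃ j ∈ (Finset.univ : Finset (Fin p)), (Q j 1 N ∪ Q j (-1) N)) :=
        ENNReal.toReal_mono (measure_ne_top _ _) (measure_mono_ae hsub)
    _ ≤ ∑ j, P.real (Q j 1 N ∪ Q j (-1) N) := measureReal_biUnion_finset_le _ _
    _ ≤ _ := Finset.sum_le_sum fun j _ => measureReal_union_le _ _

/-- The coordinatewise logarithm. -/
def logVec (z : EuclideanSpace ℝ (Fin p)) : EuclideanSpace ℝ (Fin p) :=
  WithLp.toLp 2 fun j => Real.log (z j)

lemma measurable_expVec : Measurable (expVec (p := p)) := by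
  unfold expVec; fun_prop

lemma measurable_logVec : Measurable (logVec (p := p)) := by
  unfold logVec; fun_prop

lemma logVec_expVec (u : EuclideanSpace ℝ (Fin p)) : logVec (expVec u) = u := by
  ext j; simp [logVec, expVec]

lemma lognormalLaw_eq : lognormalLaw μz σz ρ = (normalLaw μz σz ρ).map expVec := rfl

lemma hasLaw_logVec {X : Ω → EuclideanSpace ℝ (Fin p)} (hX : HasLaw X (lognormalLaw μz σz ρ) P) :
    HasLaw (fun ω => logVec (X ω)) (normalLaw μz σz ρ) P := by
  refine ⟨measurable_logVec.comp_aemeasurable hX.aemeasurable, ?_⟩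
  change P.map (logVec ∘ X) = _
  rw [← AEMeasurable.map_map_of_aemeasurable measurable_logVec.aemeasurable hX.aemeasurable,
    hX.map_eq, lognormalLaw_eq, Measure.map_map measurable_logVec measurable_expVec]
  convert Measure.map_id
  ext1 u
  exact logVec_expVec u

/-- Holds only almost surely, since `Real.log` is not inverted by exp at nonpositive values. -/
lemma ae_eq_expVec_logVec {X : Ω → EuclideanSpace ℝ (Fin p)}
    (hX : HasLaw X (lognormalLaw μz σz ρ) P) : ∀ᵐ ω ∂P, X ω = expVec (logVec (X ω)) := by
  have hm : MeasurableSet {z : EuclideanSpace ℝ (Fin p) | z = expVec (logVec z)} :=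
    measurableSet_eq_fun measurable_id (measurable_expVec.comp measurable_logVec)
  refine ae_of_ae_map (p := fun z => z = expVec (logVec z)) hX.aemeasurable ?_
  rw [hX.map_eq, lognormalLaw_eq, ae_map_iff measurable_expVec.aemeasurable hm]
  exact ae_of_all _ fun u => by rw [logVec_expVec]

/-- The subdata has at most 2rp points whatever N is, so uniform smallness of the summands suffices.
-/
theorem tendstoInMeasure_sum_missInfo [IsProbabilityMeasure P] {θ : Idx m p → ℝ}
    (r : ℕ) {C κ : ℝ} (hC : 0 ≤ C)
    (hle : ∀ z a b, |missInfo θ z a b| ≤ C * sepBound θ κ z)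
    (h : ∀ ε > 0, Tendsto (fun N => P.real {ω | ∃ i ∈ iboss r N (fun i => z i ω),
      ε ≤ sepBound θ κ (z i ω)}) atTop (𝓝 0)) (a b : Idx m p) :
    TendstoInMeasure P
      (fun N ω => (∑ i ∈ iboss r N (fun i => z i ω), missInfo θ (z i ω)) a b)
      atTop (fun _ => 0) := by
  rw [tendstoInMeasure_iff_measureReal_norm]
  intro ε hε
  set M : ℝ := ((2 * r * p : ℕ) : ℝ) with hM
  have hM0 : 0 ≤ M := Nat.cast_nonneg _
  refine squeeze_zero (fun N => measureReal_nonneg) (fun N => measureReal_mono ?_)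
    -- The added ones keep the divisor positive when M or C is 0 and make the final inequality
    -- strict.
    (h (ε / ((M + 1) * (C + 1))) (by positivity))
  intro ω hω
  by_contra! hcon
  simp only [Set.mem_ofPred_eq, not_exists, not_and, not_le] at hcon hω
  rw [sub_zero, Matrix.sum_apply] at hω
  refine absurd hω (not_le.2 ?_)
  set e := ε / ((M + 1) * (C + 1)) with he
  have he0 : 0 < e := by positivity
  calc _ ≤ ∑ i ∈ iboss r N (fun i => z i ω), |missInfo θ (z i ω) a b| :=
        Finset.abs_sum_le_sum_abs _ _
    _ ≤ ∑ i ∈ iboss r N (fun i => z i ω), C * e := by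
        refine Finset.sum_le_sum fun i hi => (hle _ _ _).trans ?_
        gcongr
        exact (hcon i hi).le
    _ = (iboss r N (fun i => z i ω)).card * (C * e) := by simp
    _ ≤ M * (C * e) := by
        gcongr
        exact Nat.cast_le.2 (card_iboss_le r N _)
    _ < (M + 1) * ((C + 1) * e) := by nlinarith [mul_nonneg hM0 hC]
    _ = ε := by rw [he]; field_simp

end

end CLR

end

theorem mainTheorem2 {m p : ℕ} (r : ℕ) (θ : CLR.Idx m p → ℝ)
    (hvar : ∀ g, 0 < CLR.var θ g) (hprop : ∀ g, 0 < CLR.prop θ g)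
    (μz : EuclideanSpace ℝ (Fin p)) (σz : Fin p → ℝ) (ρ : Matrix (Fin p) (Fin p) ℝ)
    (hσ : ∀ j, 0 < σz j) (hρ : ∀ j, ρ j j = 1)
    (hcov : (Matrix.diagonal σz * ρ * Matrix.diagonal σz).PosDef)
    {Ω : Type*} [MeasurableSpace Ω] (P : Measure Ω) [IsProbabilityMeasure P]
    (z : ℕ → Ω → EuclideanSpace ℝ (Fin p)) (hindep : iIndepFun z P)
    (hlaw :
      ((∀ i, HasLaw (z i) (CLR.normalLaw μz σz ρ) P) ∧ CLR.NormalCond θ σz ρ) ∨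
      ((∀ i, HasLaw (z i) (CLR.lognormalLaw μz σz ρ) P) ∧ CLR.LognormalCond θ ρ)) :
    (∀ x, CLR.info θ x = CLR.complInfo θ x - CLR.missInfo θ x) ∧
    (∀ x, CLR.complInfo θ x = CLR.closedForm θ x) ∧
    (∀ a b, TendstoInMeasure P
      (fun N ω => (∑ i ∈ CLR.iboss r N (fun i => z i ω), CLR.missInfo θ (z i ω)) a b)
      atTop (fun _ => 0)) ∧
    (∀ a b, TendstoInMeasure P
      (fun N ω => ((∑ i ∈ CLR.iboss r N (fun i => z i ω), CLR.complInfo θ (z i ω)) -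
        (∑ i ∈ CLR.iboss r N (fun i => z i ω), CLR.info θ (z i ω))) a b)
      atTop (fun _ => 0)) := by
  have hinfo := CLR.info_eq_complInfo_sub_missInfo hvar hprop
  obtain ⟨C, κ, hC, hκ, hle⟩ := CLR.exists_missInfo_le hvar hprop
  have hmiss : ∀ a b, TendstoInMeasure P
      (fun N ω => (∑ i ∈ CLR.iboss r N (fun i => z i ω), CLR.missInfo θ (z i ω)) a b)
      atTop (fun _ => 0) := by
    refine CLR.tendstoInMeasure_sum_missInfo r hC hle fun ε hε => ?_
    rcases hlaw with ⟨hz, hcond⟩ | ⟨hz, hcond⟩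
    · exact CLR.tendsto_measure_exists_iboss_le_sepBound r θ κ hσ hρ hcov hz hindep
        measurable_id (fun _ _ _ => Iff.rfl)
        (fun j τ hτ => ae_of_all _ fun x => CLR.tendsto_sepBound_normal hκ hσ hcond j hτ _)
        (ae_of_all _ fun ω i => rfl) hε
    · exact CLR.tendsto_measure_exists_iboss_le_sepBound r θ κ hσ hρ hcov
        (fun i => CLR.hasLaw_logVec (hz i))
        (hindep.comp (fun _ => CLR.logVec) fun _ => CLR.measurable_logVec)
        CLR.measurable_expVec (fun x y j => by simp [CLR.expVec])
        (fun j τ hτ => CLR.tendsto_sepBound_lognormal hκ hσ hρ hcov hcond j hτ)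
        (ae_all_iff.2 fun i => CLR.ae_eq_expVec_logVec (hz i)) hε
  refine ⟨hinfo, CLR.complInfo_eq_closedForm hvar hprop, hmiss, fun a b => ?_⟩
  simpa only [hinfo, ← Finset.sum_sub_distrib, sub_sub_cancel] using hmiss a b
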